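/- **Conventions.** Let $N$ be a countably infinite structure in a relational language $L_N$ that is computable (its relation symbols are injectively numbered, the set of numbers is decidable and the arity is computable). Assume that $Th(N)$ is $\omega$-categorical, model complete and decidable. **The structure $M_0$.** Let $L_E=\{E_n : n\ge 1\}$ with $E_n$ of arity $2n$. Consider the finite $L_E$-structures in which each $E_n$ is an equivalence relation on the set of $n$-tuples such that the $n$-tuples with a repeated coordinate (if there are any) form exactly one $E_n$-class. Let $M$ be the countable universal homogeneous structure (Fraïssé limit) of this class, and for $n\ge1$ let $S_n$ be the set of $E_n$-classes of $n$-tuples of $M$ without repeated coordinates, with $\pi_n$ the projection onto $S_n$. Put a model of $Th(N)$ on the set $S_1$, and interpret each $k$-ary symbol $R$ of $L_N$ in $M$ by $R(a_1,\dots,a_k)\Leftrightarrow R(\pi_1(a_1),\dots,\pi_1(a_k))$. The resulting structure in the language $L_0=L_E\cup L_N$ is $M_0$. Fix a presentation of $M_0$ with universe $\omega$ and decidable elementary diagram. **The theory $T$ and the space $\mathbf X_{M_0}$.** Let $L=L_0\cup\{P_{n,i}: n\ge 2,\ i\in\omega\}$ with $P_{n,i}$ of arity $n$, and let $T$ be the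 $L$-theory of all expansions of such countable $L_0$-structures in which each $P_{n,i}$ is interpreted as $\pi_n^{-1}(U_{n,i})$ for some $U_{n,i}\subseteq S_n$. Let $\mathbf X_{M_0}$ be the set of all expansions of $M_0$ to models of $T$, with the natural action of $G=Aut(M_0)$. Let $\mathcal A=\{A_j\}$ be the basis of $\mathbf X_{M_0}$ consisting of the sets of all expansions with a given diagram; a diagram is given by a finite tuple $\bar a$ from $M_0$ and a finite tuple of symbols $P_{n,i}$, and says for each of these symbols which tuples from $\bar a$ satisfy it. Diagrams are coded effectively by natural numbers. **Canonical pieces and degrees.** The pieces of the canonical partition of $\mathbf X_{M_0}$ are the non-empty sets of the form $\bigcap\{GA_j : t(j)=1\}\cap\bigcap\{\mathbf X_{M_0}\setminus GA_j : t(j)=0\}$, where $t$ is a $0$-$1$-function on the set of indices $j$. The degree of $x\in\mathbf X_{M_0}$ is the Turing degree of the set $Sat_x(\mathcal A)$ of (codes of) members of $\mathcal A$ containing $x$. An orbit $Gx$ is of degree $\mathbf d$ if $\mathbf d$ is the least of the degrees of the members of $Gx$; if there is no least one, then $Gx$ has no degree. **Theorem 4.4.** For every such presentation of $M_0$ the canonical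 partition of the $Aut(M_0)$-space $\mathbf X_{M_0}$ has (i) for every Turing degree $\mathbf d$, a piece that is a $G$-orbit of degree $\mathbf d$; (ii) a piece that is a $G$-orbit having no degree. -/

import Mathlib

open FirstOrder FirstOrder.Language

/-! ### Computable relational languages, decidable theories and presentations -/

/-- A computable presentation of a relational language: an injective numbering of its relation
symbols for which it is decidable whether a number is the number of a symbol, and the arity of
the symbol with a given number is computable. -/
structure ComputableLanguage (L : FirstOrder.Language.{0, 0}) where
  symCode : (Σ n, L.Relations n) → ℕ
  injective : Function.Injective symCode
  arity : ℕ → Option ℕ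
  computable_arity : Computable arity
  arity_eq : ∀ m n, arity m = some n ↔ ∃ R : L.Relations n, symCode ⟨n, R⟩ = m

/-- Gödel number of a term (that is, of a variable) of a relational language. -/
def termCode {L : FirstOrder.Language.{0, 0}} [L.IsRelational] {α : Type} [Encodable α] {n : ℕ} :
    L.Term (α ⊕ Fin n) → ℕ
  | .var (.inl a) => 2 * Encodable.encode a
  | .var (.inr i) => 2 * (i : ℕ) + 1
  | .func f _ => isEmptyElim f

/-- Gödel number of a formula of a relational language whose symbols are numbered by `c`. -/
def formulaCode {L : FirstOrder.Language.{0, 0}} [L.IsRelational] (c : (Σ n, L.Relations n) → ℕ)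
    {α : Type} [Encodable α] : ∀ {n : ℕ}, L.BoundedFormula α n → ℕ
  | _, .falsum => Nat.pair 0 0
  | _, .equal s t => Nat.pair 1 (Nat.pair (termCode s) (termCode t))
  | _, .rel (l := l) R ts =>
      Nat.pair 2 (Nat.pair (c ⟨l, R⟩) (Encodable.encode (List.ofFn fun i => termCode (ts i))))
  | _, .imp φ ψ => Nat.pair 3 (Nat.pair (formulaCode c φ) (formulaCode c ψ))
  | _, .all φ => Nat.pair 4 (formulaCode c φ)

/-- The first-order theory of `N` is decidable. -/
def HasDecidableTheory {L : FirstOrder.Language.{0, 0}} [L.IsRelational] (c : (Σ n, L.Relations n) → ℕ)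
    (N : Type) [L.Structure N] : Prop :=
  ComputablePred fun m : ℕ => ∃ φ : L.Sentence, formulaCode c φ = m ∧ N ⊨ φ

/-- The elementary diagram of a structure with universe `ℕ` is decidable. A formula with
parameters is a formula with free variables from `ℕ`, in which the variable `k` stands for
the element `k`. -/
def HasDecidableElementaryDiagram {L : FirstOrder.Language.{0, 0}} [L.IsRelational]
    (c : (Σ n, L.Relations n) → ℕ) [L.Structure ℕ] : Prop :=
  ComputablePred fun m : ℕ => ∃ φ : L.Formula ℕ, formulaCode c φ = m ∧ φ.Realize id

/-- A theory is model complete if every embedding between its models is elementary. -/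
def IsModelComplete {L : FirstOrder.Language.{0, 0}} (T : L.Theory) : Prop :=
  ∀ (A B : Theory.ModelType.{0, 0, 0} T) (f : A ↪[L] B) (n : ℕ) (φ : L.Formula (Fin n))
    (v : Fin n → A), φ.Realize (f ∘ v) ↔ φ.Realize v

/-! ### The universal homogeneous structure with equivalence relations on tuples -/

/-- Relation symbols: for each `n`, one symbol for a relation between `(n + 1)`-tuples. -/
inductive ERel : ℕ → Type
  | E (n : ℕ) : ERel ((n + 1) + (n + 1))

/-- The language `L_E`. -/
def langE : FirstOrder.Language.{0, 0} := ⟨fun _ => Empty, ERel⟩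

instance : langE.IsRelational := fun _ => (inferInstance : IsEmpty Empty)

/-- The relation `E_{n+1}` between `(n + 1)`-tuples. -/
def eRel {M : Type} [langE.Structure M] {n : ℕ} (a b : Fin (n + 1) → M) : Prop :=
  Structure.RelMap (L := langE) (ERel.E n) (Fin.append a b)

/-- Each `E_n` is an equivalence relation on `n`-tuples, one class of which consists exactly of
the tuples with a repeated coordinate (if there are any). -/
def IsEStructure (M : Type) [langE.Structure M] : Prop :=
  ∀ n : ℕ, Equivalence (eRel : (Fin (n + 1) → M) → (Fin (n + 1) → M) → Prop) ∧
    ∀ a b : Fin (n + 1) → M, ¬ Function.Injective a → (eRel a b ↔ ¬ Function.Injective b)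

/-- The class of finite `L_E`-structures of this kind. -/
def classE : Set (CategoryTheory.Bundled.{0} langE.Structure) :=
  {A | Finite A ∧ IsEStructure A}

/-- The sort of classes of `E_{n+1}` on the `(n + 1)`-tuples without repeated coordinates. -/
def ESort (n : ℕ) (M : Type) [langE.Structure M] : Type :=
  Quot fun a b : {a : Fin (n + 1) → M // Function.Injective a} => eRel a.1 b.1

/-- The projection of the tuples without repeated coordinates onto their sort. -/
def eProj {M : Type} [langE.Structure M] {n : ℕ} (a : Fin (n + 1) → M)
    (h : Function.Injective a) : ESort n M :=
  Quot.mk _ ⟨a, h⟩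

/-- The projection of the elements of `M` onto the sort of `E_1`-classes. -/
def eProjOne {M : Type} [langE.Structure M] (m : M) : ESort 0 M :=
  eProj (fun _ => m) fun i j _ => Subsingleton.elim (α := Fin 1) i j

/-! ### The structure `M₀`, the theory `T` and the space of expansions -/

/-- The language `L₀`: `L_E` together with the language of `N`. -/
abbrev langZero (LN : FirstOrder.Language.{0, 0}) : FirstOrder.Language.{0, 0} := langE.sum LN

instance (LN : FirstOrder.Language.{0, 0}) [LN.IsRelational] : (langZero LN).IsRelational :=
  inferInstance

/-- The index `n` of the symbol `E n`. -/
def ERel.index : ∀ {k : ℕ}, ERel k → ℕ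
  | _, .E n => n

/-- The numbering of the symbols of `L₀` obtained from a numbering for the language of `N`. -/
def symCodeZero {LN : FirstOrder.Language.{0, 0}} (c : (Σ n, LN.Relations n) → ℕ) :
    (Σ n, (langZero LN).Relations n) → ℕ
  | ⟨_, .inl e⟩ => 2 * ERel.index e
  | ⟨k, .inr R⟩ => 2 * c ⟨k, R⟩ + 1

/-- `M` is the `L₀`-structure constructed from `N`: its reduct to `L_E` is the countable universal
homogeneous structure, and the symbols of the language of `N` are interpreted in `M` by
pulling back a model of `Th(N)` whose universe is the sort of `E_1`-classes. -/
def IsBaseStructure (LN : FirstOrder.Language.{0, 0}) (N : Type) [LN.Structure N]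
    (M : Type) [Countable M] [langE.Structure M] [LN.Structure M] : Prop :=
  IsFraisseLimit classE M ∧
    ∃ S : LN.Structure (ESort 0 M),
      (letI := S; ESort 0 M ⊨ LN.completeTheory N) ∧
      ∀ (k : ℕ) (R : LN.Relations k) (a : Fin k → M),
        Structure.RelMap R a ↔ S.RelMap R (fun j => eProjOne (a j))

/-- The new relation symbols: `P n i` is the `i`-th symbol of arity `n + 2`. -/
inductive PRel : ℕ → Type
  | P (n i : ℕ) : PRel (n + 2)

/-- The language of the new relation symbols. -/
def langP : FirstOrder.Language.{0, 0} := ⟨fun _ => Empty, PRel⟩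

/-- The interpretation of `P n i` in a structure. -/
def pRel {M : Type} (x : langP.Structure M) (n i : ℕ) (a : Fin (n + 2) → M) : Prop :=
  x.RelMap (PRel.P n i) a

/-- The language `L`. -/
abbrev langFull (LN : FirstOrder.Language.{0, 0}) : FirstOrder.Language.{0, 0} := (langZero LN).sum langP

/-- `M` is one of the structures `M*`: an `L`-structure whose `L₀`-reduct is constructed from `N`
as above, and in which the new symbols of arity `n + 2` are interpreted by pulling back subsets
of the sort of `E_{n+2}`-classes (of tuples without repeated coordinates). -/
def IsStarStructure (LN : FirstOrder.Language.{0, 0}) (N : Type) [LN.Structure N]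
    (M : Type) [Countable M] [langE.Structure M] [LN.Structure M] [x : langP.Structure M] : Prop :=
  IsBaseStructure LN N M ∧
    ∃ U : ∀ n : ℕ, ℕ → Set (ESort (n + 1) M), ∀ (n i : ℕ) (a : Fin (n + 2) → M),
      pRel x n i a ↔ ∃ h : Function.Injective a, eProj a h ∈ U n i

/-- The theory `T` of all the structures `M*`. -/
def starTheory (LN : FirstOrder.Language.{0, 0}) (N : Type) [LN.Structure N] : (langFull LN).Theory :=
  {φ | ∀ (M : Type) [Countable M] [langE.Structure M] [LN.Structure M] [langP.Structure M],
    IsStarStructure LN N M → M ⊨ φ}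

/-- The space of all expansions of the `L₀`-structure with universe `ℕ` to models of `T`. -/
def Expansions (LN : FirstOrder.Language.{0, 0}) (N : Type) [LN.Structure N]
    [langE.Structure ℕ] [LN.Structure ℕ] : Type :=
  {x : langP.Structure ℕ // letI := x; ℕ ⊨ starTheory LN N}

/-- The automorphism group of a structure with universe `ℕ`, as a subgroup of `S_∞`. -/
def autGroup (L : FirstOrder.Language.{0, 0}) [L.Structure ℕ] : Subgroup (Equiv.Perm ℕ) where
  carrier := {g | (∀ (n : ℕ) (f : L.Functions n) (a : Fin n → ℕ),
      g (Structure.funMap f a) = Structure.funMap f (g ∘ a)) ∧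
    ∀ (n : ℕ) (R : L.Relations n) (a : Fin n → ℕ),
      Structure.RelMap R (g ∘ a) ↔ Structure.RelMap R a}
  one_mem' := ⟨fun _ _ _ => rfl, fun _ _ _ => Iff.rfl⟩
  mul_mem' := by
    rintro g h ⟨hg, hg'⟩ ⟨hh, hh'⟩
    refine ⟨fun n f a => ?_, fun n R a => ?_⟩
    · rw [Equiv.Perm.mul_apply, hh, hg]; rfl
    · exact (hg' n R (h ∘ a)).trans (hh' n R a)
  inv_mem' := by
    rintro g ⟨hg, hg'⟩
    have key : ∀ (n : ℕ) (a : Fin n → ℕ), g ∘ ((g⁻¹ : Equiv.Perm ℕ) ∘ a) = a := by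
      intro n a; funext j; simp
    refine ⟨fun n f a => ?_, fun n R a => ?_⟩
    · rw [Equiv.Perm.inv_eq_iff_eq, hg, key]
    · rw [← hg' n R, key]

/-- The image of an expansion under an automorphism of the `L₀`-structure is an expansion to a
model of `T`. -/
theorem model_inducedStructure {LN : FirstOrder.Language.{0, 0}} {N : Type} [LN.Structure N]
    [langE.Structure ℕ] [LN.Structure ℕ] (g : autGroup (langZero LN)) (x : Expansions LN N) :
    letI := @Equiv.inducedStructure langP ℕ ℕ x.1 g.1
    ℕ ⊨ starTheory LN N := by
  let A : (langFull LN).Structure ℕ := @sumStructure _ _ ℕ _ x.1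
  let B : (langFull LN).Structure ℕ :=
    @sumStructure _ _ ℕ _ (@Equiv.inducedStructure langP ℕ ℕ x.1 g.1)
  have key : ∀ (n : ℕ) (a : Fin n → ℕ), g.1.symm ∘ (g.1 ∘ a) = a := by
    intro n a; funext j; simp
  let e : @FirstOrder.Language.Equiv (langFull LN) ℕ ℕ A B :=
    @FirstOrder.Language.Equiv.mk (langFull LN) ℕ ℕ A B g.1
      (by
        rintro n (f | f) a
        · exact g.2.1 n f a
        · exact f.elim)
      (by
        rintro n (R | R) a
        · exact g.2.2 n R a
        · change x.1.RelMap R (g.1.symm ∘ (g.1 ∘ a)) ↔ x.1.RelMap R a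
          rw [key])
  exact (@StrongHomClass.theory_model (langFull LN) ℕ ℕ A B (starTheory LN N) _ _ _ e x.2)

/-- The logic action: `g • x` is the expansion for which `g` is an isomorphism from `x`. -/
instance instMulActionExpansions (LN : FirstOrder.Language.{0, 0}) (N : Type) [LN.Structure N]
    [langE.Structure ℕ] [LN.Structure ℕ] :
    MulAction (autGroup (langZero LN)) (Expansions LN N) where
  smul g x := ⟨@Equiv.inducedStructure langP ℕ ℕ x.1 g.1, model_inducedStructure g x⟩
  one_smul x := by
    apply Subtype.ext
    apply Structure.ext
    · funext n f; exact f.elim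
    · rfl
  mul_smul g h x := by
    apply Subtype.ext
    apply Structure.ext
    · funext n f; exact f.elim
    · rfl

/-! ### The canonical partition -/

/-- The set `G A`. -/
def saturation (G : Type*) {X : Type*} [Group G] [MulAction G X] (A : Set X) : Set X :=
  {x | ∃ g : G, ∃ a ∈ A, g • a = x}

/-- `Y` is a piece of the canonical partition of the `G`-space with the basis `A`: it is non-empty,
and for some 0-1-function `t` on the index set it is the intersection of the sets `G (A j)` with
`t j = 1` and of the complements of the sets `G (A j)` with `t j = 0`. -/
def IsCanonicalPiece (G : Type*) {X ι : Type*} [Group G] [MulAction G X] (A : ι → Set X)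
    (Y : Set X) : Prop :=
  Y.Nonempty ∧ ∃ t : ι → Bool,
    Y = (⋂ j ∈ {j | t j = true}, saturation G (A j)) ∩
      ⋂ j ∈ {j | t j = false}, (saturation G (A j))ᶜ

/-! ### The basis of diagrams, and degrees -/

/-- A diagram is given by a tuple of elements of `M₀ = ℕ`, a tuple of new relation symbols
(`(n, i)` stands for `P n i`), and the list of the atomic facts that are chosen to hold. -/
abbrev DiagramCode : Type := List ℕ × List (ℕ × ℕ) × List ((ℕ × ℕ) × List ℕ)

/-- The basic clopen set of all expansions with the given diagram: each of the listed symbols holds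
of a tuple from the listed elements if and only if this fact was chosen to hold. -/
def basicSet {LN : FirstOrder.Language.{0, 0}} {N : Type} [LN.Structure N]
    [langE.Structure ℕ] [LN.Structure ℕ] (D : DiagramCode) : Set (Expansions LN N) :=
  {x | ∀ p ∈ D.2.1, ∀ b : Fin (p.1 + 2) → ℕ, (∀ j, b j ∈ D.1) →
    (pRel x.1 p.1 p.2 b ↔ (p, List.ofFn b) ∈ D.2.2)}

/-- The set of (codes of) basic sets to which `x` belongs. -/
def satSet {LN : FirstOrder.Language.{0, 0}} {N : Type} [LN.Structure N]
    [langE.Structure ℕ] [LN.Structure ℕ] (x : Expansions LN N) : Set ℕ :=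
  {m | ∃ D : DiagramCode, Encodable.encode D = m ∧ x ∈ basicSet D}

open Classical in
/-- The characteristic function of a set of natural numbers. -/
noncomputable def charFun (A : Set ℕ) : ℕ →. ℕ := fun m => Part.some (if m ∈ A then 1 else 0)

/-- Turing reducibility of sets of natural numbers. -/
def SetTuringReducible (A B : Set ℕ) : Prop := TuringReducible (charFun A) (charFun B)

/-- The Turing degree of the set `D` is the least among the degrees of the members of `Y`, where
the degree of a member `y` is the degree of `satSet y`. -/
def HasDegreeOf {LN : FirstOrder.Language.{0, 0}} {N : Type} [LN.Structure N]
    [langE.Structure ℕ] [LN.Structure ℕ] (Y : Set (Expansions LN N)) (D : Set ℕ) : Prop :=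
  (∃ y ∈ Y, SetTuringReducible (satSet y) D ∧ SetTuringReducible D (satSet y)) ∧
    ∀ y ∈ Y, SetTuringReducible D (satSet y)

/-!
Expansions in which every `P_{n,i}` is `Aut(M₀)`-invariant have one-point orbits; letting `P_{n,i}`
hold of all tuples without repeated coordinates or of none, according to `i ∈ D`, realizes every
degree. For (ii), let `P_{n,0}` be empty or a single `E_n`-class. Automorphisms of `M₀` move the
classes for different `n` independently, so the orbit of such an expansion is determined by the set
of the `n` for which `P_{n,0}` is not empty. If the orbit had a degree `D`, then `D` would be
computable from both members of a pair of expansions in the orbit that is generic among the pairs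
with equal supports. By genericity some finite part of the pair forces the two computations to
agree, so `D` can be computed by searching for arbitrary finite extensions of this part. Hence `D`,
and with it some member of the orbit, is computable; but a generic support is not the support of any
of the countably many computable expansions.
-/

/-! ### Oracle computations -/

/-- `p` is the union of the increasing sequence `F` of partial values. This expresses that a
computation with an oracle is the limit of computations with finite parts of the oracle. -/
structure IsPartLimit {σ : Type*} (F : ℕ → Part σ) (p : Part σ) : Prop where
  mono : ∀ m m' v, m ≤ m' → v ∈ F m → v ∈ F m'
  mem_iff : ∀ v, v ∈ p ↔ ∃ m, v ∈ F m

namespace IsPartLimit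

variable {σ τ : Type*}

theorem const (p : Part σ) : IsPartLimit (fun _ => p) p :=
  ⟨fun _ _ _ _ h => h, fun _ => ⟨fun h => ⟨0, h⟩, fun ⟨_, h⟩ => h⟩⟩

theorem bind {F : ℕ → Part σ} {p : Part σ} {G : σ → ℕ → Part τ} {q : σ → Part τ}
    (hF : IsPartLimit F p) (hG : ∀ a, IsPartLimit (G a) (q a)) :
    IsPartLimit (fun m => (F m).bind fun a => G a m) (p.bind q) where
  mono m m' v hm h := by
    obtain ⟨a, ha, hv⟩ := Part.mem_bind_iff.1 h
    exact Part.mem_bind_iff.2 ⟨a, hF.mono m m' a hm ha, (hG a).mono m m' v hm hv⟩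
  mem_iff v := by
    constructor
    · intro h
      obtain ⟨a, ha, hv⟩ := Part.mem_bind_iff.1 h
      obtain ⟨m₁, h₁⟩ := (hF.mem_iff a).1 ha
      obtain ⟨m₂, h₂⟩ := ((hG a).mem_iff v).1 hv
      exact ⟨max m₁ m₂, Part.mem_bind_iff.2 ⟨a, hF.mono _ _ _ (le_max_left _ _) h₁,
        (hG a).mono _ _ _ (le_max_right _ _) h₂⟩⟩
    · rintro ⟨m, h⟩
      obtain ⟨a, ha, hv⟩ := Part.mem_bind_iff.1 h
      exact Part.mem_bind_iff.2 ⟨a, (hF.mem_iff a).2 ⟨m, ha⟩, ((hG a).mem_iff v).2 ⟨m, hv⟩⟩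

theorem map {F : ℕ → Part σ} {p : Part σ} (hF : IsPartLimit F p) (f : σ → τ) :
    IsPartLimit (fun m => (F m).map f) (p.map f) := by
  simpa only [Part.bind_some_eq_map] using hF.bind fun a => const (Part.some (f a))

theorem natRec {F : ℕ → Part σ} {p : Part σ} {G : ℕ → σ → ℕ → Part σ} {q : ℕ → σ → Part σ}
    (hF : IsPartLimit F p) (hG : ∀ y a, IsPartLimit (G y a) (q y a)) (n : ℕ) :
    IsPartLimit
      (fun m => (Nat.rec (F m) (fun y IH => IH.bind fun i => G y i m) n : Part σ))
      (Nat.rec p (fun y IH => IH.bind fun i => q y i) n) := by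
  induction n with
  | zero => exact hF
  | succ n ih => exact ih.bind (hG n)

theorem rfind {F : ℕ → ℕ → Part Bool} {p : ℕ →. Bool} (h : ∀ n, IsPartLimit (F n) (p n)) :
    IsPartLimit (fun m => Nat.rfind (fun n => F n m : ℕ →. Bool)) (Nat.rfind p) where
  mono m m' v hm hv := by
    have hv := Nat.mem_rfind.1 hv
    exact Nat.mem_rfind.2
      ⟨(h v).mono _ _ _ hm hv.1, fun {k} hk => (h k).mono _ _ _ hm (hv.2 hk)⟩
  mem_iff v := by
    refine Iff.trans Nat.mem_rfind (Iff.trans ?_ (exists_congr fun m => Nat.mem_rfind.symm))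
    constructor
    · rintro ⟨h₁, h₂⟩
      obtain ⟨m₁, hm₁⟩ := ((h v).mem_iff _).1 h₁
      have h₃ : ∀ k, ∃ m, k < v → false ∈ F k m := fun k => by
        by_cases hk : k < v
        · obtain ⟨m, hm⟩ := ((h k).mem_iff _).1 (h₂ hk)
          exact ⟨m, fun _ => hm⟩
        · exact ⟨0, fun h => absurd h hk⟩
      choose u hu using h₃
      refine ⟨max m₁ ((Finset.range v).sup u), (h v).mono _ _ _ (le_max_left _ _) hm₁,
        fun {k} hk => (h k).mono _ _ _ ?_ (hu k hk)⟩
      exact (Finset.le_sup (f := u) (Finset.mem_range.2 hk)).trans (le_max_right _ _)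
    · rintro ⟨m, h₁, h₂⟩
      exact ⟨((h v).mem_iff _).2 ⟨m, h₁⟩, fun hk => ((h _).mem_iff _).2 ⟨m, h₂ hk⟩⟩

end IsPartLimit

/-- The list of the first `m` values of `g`. -/
def initialSegment {σ : Type*} (g : ℕ → σ) (m : ℕ) : List σ := (List.range m).map g

theorem initialSegment_succ {σ : Type*} (g : ℕ → σ) (m : ℕ) :
    initialSegment g (m + 1) = initialSegment g m ++ [g m] := by
  simp [initialSegment, List.range_succ]

theorem getElem?_initialSegment {σ : Type*} (g : ℕ → σ) (m i : ℕ) :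
    (initialSegment g m)[i]? = if i < m then some (g i) else none := by
  split_ifs with h <;> simp [initialSegment, h]

theorem initialSegment_congr {σ : Type*} {g g' : ℕ → σ} {m : ℕ} (h : ∀ i < m, g i = g' i) :
    initialSegment g m = initialSegment g' m :=
  List.map_congr_left fun i hi => h i (List.mem_range.1 hi)

/-- `f` is computed from finite initial segments of the oracle `g`, in such a way that longer
segments do not change the values already found (the use principle). -/
def IsSegmentComputable (g : ℕ → ℕ) (f : ℕ →. ℕ) : Prop :=
  ∃ F : List ℕ → ℕ →. ℕ, Partrec₂ F ∧ ∀ k, IsPartLimit (fun m => F (initialSegment g m) k) (f k)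

namespace IsSegmentComputable

variable {g : ℕ → ℕ} {f h : ℕ →. ℕ}

theorem of_partrec (hf : Partrec f) : IsSegmentComputable g f :=
  ⟨fun _ => f, hf.comp Computable.snd, fun k => .const (f k)⟩

theorem oracle (g : ℕ → ℕ) : IsSegmentComputable g fun n => Part.some (g n) := by
  refine ⟨fun s k => (s[k]? : Option ℕ), Computable.ofOption
    (Computable.list_getElem?.comp Computable.fst Computable.snd), fun k => ⟨?_, ?_⟩⟩
  · intro m m' v hm
    simp only [getElem?_initialSegment]
    split_ifs with h₁ h₂
    · exact id
    · omega
    · simp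
    · simp
  · intro v
    simp only [getElem?_initialSegment]
    constructor
    · exact fun h => ⟨k + 1, by simpa using h⟩
    · rintro ⟨m, hm⟩
      split_ifs at hm
      · simpa using hm
      · simp at hm

theorem pair (hf : IsSegmentComputable g f) (hh : IsSegmentComputable g h) :
    IsSegmentComputable g fun n => (f n).bind fun a => (h n).map (Nat.pair a) := by
  obtain ⟨F, hF, hFf⟩ := hf
  obtain ⟨H, hH, hHh⟩ := hh
  refine ⟨fun s n => (F s n).bind fun a => (H s n).map (Nat.pair a), ?_,
    fun k => (hFf k).bind fun a => (hHh k).map (Nat.pair a)⟩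
  refine Partrec.bind hF (Partrec.map (f := fun q : (List ℕ × ℕ) × ℕ => H q.1.1 q.1.2)
    (hH.comp (Computable.fst.comp Computable.fst) (Computable.snd.comp Computable.fst)) ?_)
  exact Primrec₂.natPair.to_comp.comp (Computable.snd.comp Computable.fst) Computable.snd

theorem comp (hf : IsSegmentComputable g f) (hh : IsSegmentComputable g h) :
    IsSegmentComputable g fun n => (h n).bind f := by
  obtain ⟨F, hF, hFf⟩ := hf
  obtain ⟨H, hH, hHh⟩ := hh
  exact ⟨fun s n => (H s n).bind (F s),
    Partrec.bind hH (hF.comp (Computable.fst.comp Computable.fst) Computable.snd),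
    fun k => (hHh k).bind hFf⟩

theorem prec (hf : IsSegmentComputable g f) (hh : IsSegmentComputable g h) :
    IsSegmentComputable g fun p => (Nat.rec (f p.unpair.1) (fun y IH => IH.bind fun i =>
      h (Nat.pair p.unpair.1 (Nat.pair y i))) p.unpair.2 : Part ℕ) := by
  obtain ⟨F, hF, hFf⟩ := hf
  obtain ⟨H, hH, hHh⟩ := hh
  refine ⟨fun s p => (Nat.rec (F s p.unpair.1) (fun y IH => IH.bind fun i =>
    H s (Nat.pair p.unpair.1 (Nat.pair y i))) p.unpair.2 : Part ℕ), ?_, fun k =>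
    (hFf k.unpair.1).natRec (fun y i => hHh (Nat.pair k.unpair.1 (Nat.pair y i))) k.unpair.2⟩
  refine Partrec.nat_rec (f := fun q : List ℕ × ℕ => q.2.unpair.2)
    (g := fun q : List ℕ × ℕ => F q.1 q.2.unpair.1)
    (h := fun (q : List ℕ × ℕ) (r : ℕ × ℕ) => H q.1 (Nat.pair q.2.unpair.1 (Nat.pair r.1 r.2)))
    ?_ ?_ ?_
  · exact Computable.snd.comp (Computable.unpair.comp Computable.snd)
  · exact hF.comp Computable.fst (Computable.fst.comp (Computable.unpair.comp Computable.snd))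
  · refine hH.comp (Computable.fst.comp Computable.fst) ?_
    exact Primrec₂.natPair.to_comp.comp
      (Computable.fst.comp (Computable.unpair.comp (Computable.snd.comp Computable.fst)))
      (Primrec₂.natPair.to_comp.comp (Computable.fst.comp Computable.snd)
        (Computable.snd.comp Computable.snd))

theorem rfind (hf : IsSegmentComputable g f) :
    IsSegmentComputable g fun a =>
      Nat.rfind fun n => (f (Nat.pair a n)).map fun m => decide (m = 0) := by
  obtain ⟨F, hF, hFf⟩ := hf
  refine ⟨fun s a => Nat.rfind fun n => (F s (Nat.pair a n)).map fun m => decide (m = 0), ?_,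
    fun k => .rfind fun n => (hFf (Nat.pair k n)).map fun m => decide (m = 0)⟩
  refine Partrec.rfind (p := fun (q : List ℕ × ℕ) n =>
    (F q.1 (Nat.pair q.2 n)).map fun m => decide (m = 0)) ?_
  refine Partrec.map (f := fun r : (List ℕ × ℕ) × ℕ => F r.1.1 (Nat.pair r.1.2 r.2))
    (hF.comp (Computable.fst.comp Computable.fst) (Primrec₂.natPair.to_comp.comp
      (Computable.snd.comp Computable.fst) Computable.snd)) ?_
  exact ((Primrec.eq (α := ℕ)).decide.comp Primrec.snd (Primrec.const 0)).to_comp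

theorem of_recursiveIn (hf : Nat.RecursiveIn {fun n => Part.some (g n)} f) :
    IsSegmentComputable g f := by
  induction hf with
  | zero => exact of_partrec (Computable.const 0).partrec
  | succ => exact of_partrec Computable.succ.partrec
  | left => exact of_partrec (Computable.fst.comp Computable.unpair).partrec
  | right => exact of_partrec (Computable.snd.comp Computable.unpair).partrec
  | oracle o ho =>
    obtain rfl : o = fun n => Part.some (g n) := ho
    exact oracle g
  | pair _ _ ihf ihh => simpa only [Seq.seq, Part.map_eq_map, Part.bind_map] using ihf.pair ihh
  | comp _ _ ihf ihh => exact ihf.comp ihh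
  | prec _ _ ihf ihh => exact ihf.prec ihh
  | rfind _ ihf => exact ihf.rfind

end IsSegmentComputable

open Classical in
/-- The characteristic function of a set as a total function; `charFun` is its lift to partial
functions. -/
noncomputable def charNat (A : Set ℕ) (m : ℕ) : ℕ := if m ∈ A then 1 else 0

theorem charFun_eq_charNat (A : Set ℕ) : charFun A = fun m => Part.some (charNat A m) := rfl

theorem charNat_eq_charNat_iff {A B : Set ℕ} {m k : ℕ} :
    charNat A m = charNat B k ↔ (m ∈ A ↔ k ∈ B) := by
  unfold charNat
  split_ifs with h₁ h₂ h₂ <;> simp [h₁, h₂]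

theorem charFun_injective : Function.Injective charFun := fun _ _ h =>
  Set.ext fun m => charNat_eq_charNat_iff.1 (Part.some_injective (congrFun h m))

open Nat.Partrec (Code) in
/-- The `e`-th Turing functional: the value at `k` computed by the program `e` from the finite part
`s` of an oracle. -/
def functional (e : Code) (s : List ℕ) (k : ℕ) : Part ℕ := e.eval (Encodable.encode (s, k))

theorem partrec₂_functional (e : Nat.Partrec.Code) : Partrec₂ (functional e) :=
  (Partrec.nat_iff.2 (Nat.Partrec.Code.exists_code.2 ⟨e, rfl⟩)).comp Computable.encode

theorem SetTuringReducible.exists_functional {A D : Set ℕ} (h : SetTuringReducible D A) :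
    ∃ e, ∀ k v, v = charNat D k ↔ ∃ m, v ∈ functional e (initialSegment (charNat A) m) k := by
  obtain ⟨F, hF, hFf⟩ :=
    IsSegmentComputable.of_recursiveIn (g := charNat A) (RecursiveIn.iff_nat.1 h)
  obtain ⟨e, he⟩ := Nat.Partrec.Code.exists_code.1 hF
  refine ⟨e, fun k v => Part.mem_some_iff.symm.trans (((hFf k).mem_iff v).trans ?_)⟩
  simp [functional, he]

/-- The searches `f a b` for all `b` are run in parallel. -/
theorem computable_of_partrec_search {α β σ : Type*} [Primcodable α] [Primcodable β]
    [Primcodable σ] {f : α → β →. σ} (hf : Partrec₂ f) {g : α → σ}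
    (sound : ∀ a b, ∀ v ∈ f a b, v = g a) (complete : ∀ a, ∃ b, g a ∈ f a b) :
    Computable g := by
  obtain ⟨e, he⟩ := Nat.Partrec.Code.exists_code.1 hf
  have eval_encode (a : α) (b : β) : e.eval (Encodable.encode (a, b)) =
      (f a b).map Encodable.encode := by simp [he]
  let search (a : α) (n : ℕ) : Option σ := (Encodable.decode n.unpair.1 : Option β).bind fun b =>
    (e.evaln n.unpair.2 (Encodable.encode (a, b))).bind Encodable.decode
  have mem_search {a : α} {v : σ} : (∃ n, v ∈ search a n) ↔ ∃ b, v ∈ f a b := by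
    simp only [search, Option.mem_def, Option.bind_eq_some_iff]
    constructor
    · rintro ⟨n, b, -, m, hm, hv⟩
      obtain ⟨w, hw, rfl⟩ := (Part.mem_map_iff _).1
        (eval_encode a b ▸ Nat.Partrec.Code.evaln_sound hm)
      obtain rfl : w = v := by simpa using hv
      exact ⟨b, hw⟩
    · rintro ⟨b, hb⟩
      obtain ⟨k, hk⟩ := Nat.Partrec.Code.evaln_complete.1
        ((eval_encode a b).symm ▸ Part.mem_map Encodable.encode hb)
      exact ⟨Nat.pair (Encodable.encode b) k, b, by simp, _, by simpa using hk, by simp⟩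
  have hsearch : Computable₂ search := by
    have hn : Primrec fun q : (α × ℕ) × β => q.1.2.unpair.2 :=
      Primrec.snd.comp (Primrec.unpair.comp (Primrec.snd.comp Primrec.fst))
    refine (Primrec.option_bind (Primrec.decode.comp
      (Primrec.fst.comp (Primrec.unpair.comp Primrec.snd))) ?_).to_comp
    refine Primrec.option_bind ?_ (Primrec.decode.comp Primrec.snd)
    exact Nat.Partrec.Code.primrec_evaln.comp (((hn.pair (Primrec.const e)).pair
      (Primrec.encode.comp ((Primrec.fst.comp Primrec.fst).pair Primrec.snd))))
  refine Partrec.of_eq_tot (Partrec.rfindOpt hsearch) fun a => ?_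
  have hdom : (Nat.rfindOpt (search a)).Dom := by
    obtain ⟨n, hn⟩ := mem_search.2 (complete a)
    exact Nat.rfindOpt_dom.2 ⟨n, g a, hn⟩
  obtain ⟨b, hb⟩ := mem_search.1 (Nat.rfindOpt_spec (Part.get_mem hdom))
  exact sound a b _ hb ▸ Part.get_mem hdom

theorem recursiveIn_of_computable {O : Set (ℕ →. ℕ)} {p : ℕ → ℕ} (hp : Computable p) :
    Nat.RecursiveIn O fun k => Part.some (p k) :=
  Nat.Partrec.recursiveIn (Partrec.nat_iff.1 hp)

theorem recursiveIn_initialSegment (g : ℕ → ℕ) :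
    Nat.RecursiveIn {fun n => Part.some (g n)}
      fun m => Part.some (Encodable.encode (initialSegment g m)) := by
  have hstep : Nat.RecursiveIn {fun n => Part.some (g n)} fun p =>
      Part.some (Encodable.encode (Denumerable.ofNat (List ℕ) p.unpair.2.unpair.2 ++
        [g p.unpair.2.unpair.1])) := by
    have happend : Computable fun q : ℕ => Encodable.encode
        (Denumerable.ofNat (List ℕ) q.unpair.1 ++ [q.unpair.2]) :=
      Computable.encode.comp (Computable.list_concat.comp
        ((Computable.ofNat (List ℕ)).comp (Computable.fst.comp Computable.unpair))
        (Computable.snd.comp Computable.unpair))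
    have hsnd : Computable fun p : ℕ => p.unpair.2.unpair :=
      Computable.unpair.comp (Computable.snd.comp Computable.unpair)
    refine (Nat.RecursiveIn.comp (recursiveIn_of_computable happend) (Nat.RecursiveIn.pair
      (recursiveIn_of_computable (Computable.snd.comp hsnd))
      (Nat.RecursiveIn.comp (.oracle _ (Set.mem_singleton _))
        (recursiveIn_of_computable (Computable.fst.comp hsnd))))).of_eq fun p => ?_
    simp [Seq.seq]
  refine (Nat.RecursiveIn.comp (Nat.RecursiveIn.prec
    (recursiveIn_of_computable (Computable.const (Encodable.encode ([] : List ℕ)))) hstep)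
    (recursiveIn_of_computable
      (Primrec₂.natPair.comp (Primrec.const 0) Primrec.id).to_comp)).of_eq fun m => ?_
  simp only [Part.bind_eq_bind, Part.bind_some, Nat.unpair_pair, id]
  induction m with
  | zero => rfl
  | succ m ih => simp only [ih, initialSegment_succ, Part.bind_some, Denumerable.ofNat_encode]

namespace SetTuringReducible

variable {A D : Set ℕ}

theorem of_initialSegment {h : List ℕ → ℕ → ℕ} (hh : Computable₂ h) {b : ℕ → ℕ}
    (hb : Computable b) (hD : ∀ k, charNat D k = h (initialSegment (charNat A) (b k)) k) :
    SetTuringReducible D A := by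
  have hvalue : Computable fun q : ℕ => h (Denumerable.ofNat (List ℕ) q.unpair.1) q.unpair.2 :=
    hh.comp ((Computable.ofNat (List ℕ)).comp (Computable.fst.comp Computable.unpair))
      (Computable.snd.comp Computable.unpair)
  refine RecursiveIn.iff_nat.2 ((Nat.RecursiveIn.comp (recursiveIn_of_computable hvalue)
    (Nat.RecursiveIn.pair
      (Nat.RecursiveIn.comp (recursiveIn_initialSegment (charNat A)) (recursiveIn_of_computable hb))
      (recursiveIn_of_computable Computable.id))).of_eq fun k => ?_)
  simp [Seq.seq, charFun_eq_charNat, hD]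

theorem of_notMem {f : ℕ → ℕ} (hf : Computable f) (h : ∀ k, k ∈ D ↔ f k ∉ A) :
    SetTuringReducible D A := by
  have hget : Computable₂ fun (s : List ℕ) (k : ℕ) => 1 - s[f k]?.getD 0 :=
    Primrec.nat_sub.to_comp.comp (Computable.const 1) (Computable.option_getD
      (Computable.list_getElem?.comp Computable.fst (hf.comp Computable.snd)) (Computable.const 0))
  refine of_initialSegment hget (Computable.succ.comp hf) fun k => ?_
  by_cases hk : f k ∈ A <;> simp [getElem?_initialSegment, charNat, h k, hk]

end SetTuringReducible

theorem computable_list_all {α β : Type*} [Primcodable α] [Primcodable β] {l : α → List β}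
    {f : α → β → Bool} (hl : Computable l) (hf : Computable₂ f) :
    Computable fun a => (l a).all (f a) := by
  have key : ∀ (a : α) (n : ℕ), (Nat.rec true (fun i acc => acc &&
      (((l a)[i]?).map (f a)).getD true) n : Bool) = ((l a).take n).all (f a) := by
    intro a n
    induction n with
    | zero => simp
    | succ n ih =>
      rw [List.take_add_one, List.all_append]
      simp only [ih]
      cases (l a)[n]? <;> simp
  have : Computable fun a => (Nat.rec true (fun i acc => acc &&
      (((l a)[i]?).map (f a)).getD true) (l a).length : Bool) := by
    refine Computable.nat_rec (f := fun a => (l a).length) (g := fun _ => true)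
      (h := fun a (p : ℕ × Bool) => p.2 && (((l a)[p.1]?).map (f a)).getD true)
      (Computable.list_length.comp hl) (Computable.const true) ?_
    refine Primrec.and.to_comp.comp (Computable.snd.comp Computable.snd) ?_
    refine Computable.option_getD (Computable.option_map
      (f := fun q : α × ℕ × Bool => (l q.1)[q.2.1]?) (g := fun q b => f q.1 b)
      (Computable.list_getElem?.comp (hl.comp Computable.fst)
        (Computable.fst.comp Computable.snd)) ?_) (Computable.const true)
    exact hf.comp (Computable.fst.comp Computable.fst) Computable.snd
  exact this.of_eq fun a => by rw [key, List.take_length]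

theorem computable_initialSegment {α β : Type*} [Primcodable α] [Primcodable β] {n : α → ℕ}
    {f : α → ℕ → β} (hn : Computable n) (hf : Computable₂ f) :
    Computable fun a => initialSegment (f a) (n a) := by
  have : Computable fun a => (Nat.rec [] (fun i s => s ++ [f a i]) (n a) : List β) :=
    Computable.nat_rec (f := n) (g := fun _ => []) (h := fun a (p : ℕ × List β) => p.2 ++ [f a p.1])
      hn (Computable.const []) (Computable.list_concat.comp (Computable.snd.comp Computable.snd)
        (hf.comp Computable.fst (Computable.fst.comp Computable.snd)))
  refine this.of_eq fun a => ?_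
  induction n a with
  | zero => rfl
  | succ m ih => rw [initialSegment_succ, ← ih]

/-- The list of all `k`-tuples with entries from the list `L`; a tuple is encoded as a list of
length `k`. -/
def tuplesFrom (L : List ℕ) (k : ℕ) : List (List ℕ) :=
  Nat.rec [([] : List ℕ)] (fun _ T => T.flatMap fun t => L.map fun a => a :: t) k

theorem mem_tuplesFrom {L : List ℕ} {k : ℕ} {t : List ℕ} :
    t ∈ tuplesFrom L k ↔ t.length = k ∧ ∀ a ∈ t, a ∈ L := by
  induction k generalizing t with
  | zero =>
    have : tuplesFrom L 0 = [([] : List ℕ)] := rfl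
    rw [this, List.mem_singleton, List.length_eq_zero_iff]
    exact ⟨fun h => ⟨h, by simp [h]⟩, fun h => h.1⟩
  | succ k ih =>
    have : tuplesFrom L (k + 1) = (tuplesFrom L k).flatMap fun t => L.map fun a => a :: t := rfl
    rw [this, List.mem_flatMap]
    constructor
    · rintro ⟨s, hs, h⟩
      obtain ⟨a, ha, rfl⟩ := List.mem_map.1 h
      obtain ⟨h₁, h₂⟩ := ih.1 hs
      exact ⟨by rw [List.length_cons, h₁], List.forall_mem_cons.2 ⟨ha, h₂⟩⟩
    · rintro ⟨h₁, h₂⟩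
      cases t with
      | nil => simp at h₁
      | cons a t =>
        refine ⟨t, ih.2 ⟨by simpa using h₁, fun b hb => h₂ b (List.mem_cons_of_mem _ hb)⟩, ?_⟩
        exact List.mem_map.2 ⟨a, h₂ a List.mem_cons_self, rfl⟩

theorem primrec₂_tuplesFrom : Primrec₂ tuplesFrom := by
  refine Primrec.nat_rec' (f := fun q : List ℕ × ℕ => q.2) (g := fun _ => [([] : List ℕ)])
    (h := fun (q : List ℕ × ℕ) (p : ℕ × List (List ℕ)) =>
      p.2.flatMap fun t => q.1.map fun a => a :: t) Primrec.snd (Primrec.const _) ?_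
  refine Primrec.list_flatMap (Primrec.snd.comp Primrec.snd) ?_
  refine Primrec.list_map (Primrec.fst.comp (Primrec.fst.comp Primrec.fst)) ?_
  exact Primrec.list_cons.comp Primrec.snd (Primrec.snd.comp Primrec.fst)

theorem primrec_list_mem {α : Type*} [Primcodable α] [DecidableEq α] :
    Primrec₂ fun (a : α) (l : List α) => decide (a ∈ l) := by
  have h : PrimrecRel fun (l : List α) (b : α) => ∃ a ∈ l, a = b :=
    PrimrecRel.exists_mem_list Primrec.eq
  have h' : PrimrecRel fun (l : List α) (b : α) => b ∈ l := h.of_eq fun l b => by simp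
  exact (PrimrecRel.decide h').comp Primrec.snd Primrec.fst

theorem primrec_list_nodup : Primrec fun l : List ℕ => decide l.Nodup := by
  have h : Primrec fun l : List ℕ => (List.rec true (fun a l b => !decide (a ∈ l) && b) l : Bool) :=
    Primrec.list_rec (f := fun l : List ℕ => l) (g := fun _ => true)
      (h := fun _ (p : ℕ × List ℕ × Bool) => !decide (p.1 ∈ p.2.1) && p.2.2)
      Primrec.id (Primrec.const true)
      (Primrec.and.comp (Primrec.not.comp (primrec_list_mem.comp (Primrec.fst.comp Primrec.snd)
        (Primrec.fst.comp (Primrec.snd.comp Primrec.snd))))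
        (Primrec.snd.comp (Primrec.snd.comp Primrec.snd)))
  refine h.of_eq fun l => ?_
  induction l with
  | nil => simp
  | cons a l ih => simp [ih]

/-! ### Evaluation of diagrams -/

/-- All atomic facts about the elements and symbols of a diagram. -/
def diagramFacts (D : DiagramCode) : List ((ℕ × ℕ) × List ℕ) :=
  D.2.1.flatMap fun p => (tuplesFrom D.1 (p.1 + 2)).map fun b => (p, b)

/-- The diagram `D` is true if the truth values of the atomic facts are given by `q`. -/
def diagramHolds (q : (ℕ × ℕ) × List ℕ → Bool) (D : DiagramCode) : Bool :=
  (diagramFacts D).all fun r => q r == decide (r ∈ D.2.2)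

theorem primrec_diagramFacts : Primrec diagramFacts := by
  refine Primrec.list_flatMap (Primrec.fst.comp Primrec.snd) ?_
  refine Primrec.list_map (primrec₂_tuplesFrom.comp (Primrec.fst.comp Primrec.fst)
    (Primrec.nat_add.comp (Primrec.fst.comp Primrec.snd) (Primrec.const 2))) ?_
  exact Primrec.pair (Primrec.snd.comp Primrec.fst) Primrec.snd

theorem mem_diagramFacts {D : DiagramCode} {r : (ℕ × ℕ) × List ℕ} :
    r ∈ diagramFacts D ↔ r.1 ∈ D.2.1 ∧ r.2.length = r.1.1 + 2 ∧ ∀ a ∈ r.2, a ∈ D.1 := by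
  obtain ⟨p, b⟩ := r
  simp only [diagramFacts, List.mem_flatMap, List.mem_map, mem_tuplesFrom, Prod.mk.injEq]
  constructor
  · rintro ⟨p', hp', b', hb', rfl, rfl⟩
    exact ⟨hp', hb'⟩
  · rintro ⟨h₁, h₂⟩
    exact ⟨p, h₁, b, h₂, rfl, rfl⟩

theorem computable_diagramHolds {α : Type*} [Primcodable α] {q : α → (ℕ × ℕ) × List ℕ → Bool}
    (hq : Computable₂ q) : Computable₂ fun a D => diagramHolds (q a) D := by
  have h₁ : Computable fun t : (α × DiagramCode) × ((ℕ × ℕ) × List ℕ) => q t.1.1 t.2 :=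
    hq.comp (Computable.fst.comp Computable.fst) Computable.snd
  have h₂ : Computable fun t : (α × DiagramCode) × ((ℕ × ℕ) × List ℕ) => t.1.2.2.2 :=
    Computable.snd.comp (Computable.snd.comp (Computable.snd.comp Computable.fst))
  have h₃ : Computable fun t : (α × DiagramCode) × ((ℕ × ℕ) × List ℕ) =>
      decide (t.2 ∈ t.1.2.2.2) :=
    ((primrec_list_mem (α := (ℕ × ℕ) × List ℕ)).to_comp.comp Computable.snd h₂ :).of_eq
      fun t => decide_eq_decide.2 Iff.rfl
  have h₄ : Computable fun t : (α × DiagramCode) × ((ℕ × ℕ) × List ℕ) =>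
      (q t.1.1 t.2 == decide (t.2 ∈ t.1.2.2.2)) :=
    ((Primrec.beq (α := Bool)).to_comp.comp h₁ h₃ :).of_eq fun t => rfl
  have h₅ : Computable fun r : α × DiagramCode => diagramFacts r.2 :=
    primrec_diagramFacts.to_comp.comp Computable.snd
  exact computable_list_all h₅ (Computable₂.mk (f := fun (r : α × DiagramCode)
    (s : (ℕ × ℕ) × List ℕ) => q r.1 s == decide (s ∈ r.2.2.2)) h₄)

theorem exists_ofFn_eq {α : Type*} {l : List α} {k : ℕ} (h : l.length = k) :
    ∃ b : Fin k → α, List.ofFn b = l := by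
  subst h
  exact ⟨l.get, List.ofFn_get l⟩

/-- The characteristic function of `satSet x`, computed from the truth values of atomic facts
in `x`. -/
def satFun (q : (ℕ × ℕ) × List ℕ → Bool) (m : ℕ) : ℕ :=
  (diagramHolds q (Denumerable.ofNat DiagramCode m)).toNat

theorem computable₂_satFun {α : Type*} [Primcodable α] {q : α → (ℕ × ℕ) × List ℕ → Bool}
    (hq : Computable₂ q) : Computable₂ fun a m => satFun (q a) m := by
  have hholds : Computable fun r : α × ℕ =>
      diagramHolds (q r.1) (Denumerable.ofNat DiagramCode r.2) :=
    (computable_diagramHolds hq).comp Computable.fst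
      ((Computable.ofNat DiagramCode).comp Computable.snd)
  exact (Primrec.dom_bool Bool.toNat).to_comp.comp hholds

section SatSet

variable {LN : FirstOrder.Language.{0, 0}} {N : Type} [LN.Structure N] [langE.Structure ℕ]
  [LN.Structure ℕ]

theorem encode_mem_satSet_iff {x : Expansions LN N} {D : DiagramCode} :
    Encodable.encode D ∈ satSet x ↔ x ∈ basicSet D :=
  ⟨fun ⟨_, hD, h⟩ => Encodable.encode_injective hD ▸ h, fun h => ⟨D, rfl, h⟩⟩

theorem mem_satSet_iff {x : Expansions LN N} {m : ℕ} :
    m ∈ satSet x ↔ x ∈ basicSet (Denumerable.ofNat DiagramCode m) := by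
  rw [← encode_mem_satSet_iff, Denumerable.encode_ofNat]

theorem mem_basicSet_nil_iff {x : Expansions LN N} {L : List ℕ} {n i : ℕ} :
    x ∈ basicSet (L, [(n, i)], []) ↔
      ∀ b : Fin (n + 2) → ℕ, (∀ j, b j ∈ L) → ¬ pRel x.1 n i b := by
  simp [basicSet]

theorem mem_basicSet_iff_diagramHolds {x : Expansions LN N} {q : (ℕ × ℕ) × List ℕ → Bool}
    {D : DiagramCode}
    (h : ∀ p ∈ D.2.1, ∀ b : Fin (p.1 + 2) → ℕ, q (p, List.ofFn b) = true ↔ pRel x.1 p.1 p.2 b) :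
    x ∈ basicSet D ↔ diagramHolds q D = true := by
  simp only [diagramHolds, List.all_eq_true, mem_diagramFacts, beq_iff_eq]
  constructor
  · rintro hx ⟨p, l⟩ ⟨hp, hlength, hl⟩
    obtain ⟨b, rfl⟩ : ∃ b : Fin (p.1 + 2) → ℕ, List.ofFn b = l := exists_ofFn_eq hlength
    rw [Bool.eq_iff_iff, h p hp, decide_eq_true_iff]
    exact hx p hp b fun j => hl _ (List.mem_ofFn.2 ⟨j, rfl⟩)
  · intro hD p hp b hb
    rw [← h p hp, hD (p, List.ofFn b) ⟨hp, List.length_ofFn, List.forall_mem_ofFn_iff.2 hb⟩,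
      decide_eq_true_iff]

theorem charNat_satSet_eq_satFun {x : Expansions LN N} {q : (ℕ × ℕ) × List ℕ → Bool} {m : ℕ}
    (h : ∀ p ∈ (Denumerable.ofNat DiagramCode m).2.1, ∀ b : Fin (p.1 + 2) → ℕ,
      q (p, List.ofFn b) = true ↔ pRel x.1 p.1 p.2 b) :
    charNat (satSet x) m = satFun q m := by
  have hm := mem_satSet_iff.trans (mem_basicSet_iff_diagramHolds h)
  unfold charNat satFun
  rw [hm]
  generalize diagramHolds q (Denumerable.ofNat DiagramCode m) = v
  cases v <;> simp

theorem mem_basicSet_congr {x y : Expansions LN N} {D : DiagramCode}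
    (h : ∀ p ∈ D.2.1, ∀ b : Fin (p.1 + 2) → ℕ, (∀ j, b j ∈ D.1) →
      (pRel x.1 p.1 p.2 b ↔ pRel y.1 p.1 p.2 b)) : x ∈ basicSet D ↔ y ∈ basicSet D :=
  forall₄_congr fun p hp b hb => by rw [h p hp b hb]

end SatSet

/-! ### Structures with equivalence relations on tuples -/

theorem comp_append_fin {A B : Type*} (f : A → B) {m n : ℕ} (a : Fin m → A) (b : Fin n → A) :
    f ∘ Fin.append a b = Fin.append (f ∘ a) (f ∘ b) := by
  funext i
  refine Fin.addCases (fun i => ?_) (fun i => ?_) i <;> simp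

/-- The `L_E`-structure in which two tuples are equivalent if and only if `cls` takes the same
value on them. Every `L_E`-structure in which the relations are equivalences has this form, so that
conditions on a structure become conditions on labels. -/
abbrev eStructure {B : Type} {γ : ℕ → Type} (cls : ∀ n, (Fin (n + 1) → B) → γ n) :
    langE.Structure B where
  funMap f := isEmptyElim (α := Empty) f
  RelMap {k} (R : ERel k) := match k, R with
    | _, ERel.E n => fun v => cls n (v ∘ Fin.castAdd (n + 1)) = cls n (v ∘ Fin.natAdd (n + 1))

theorem eRel_eStructure {B : Type} {γ : ℕ → Type} (cls : ∀ n, (Fin (n + 1) → B) → γ n) {n : ℕ}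
    (a b : Fin (n + 1) → B) :
    letI := eStructure cls
    eRel a b ↔ cls n a = cls n b := by
  have h₁ : Fin.append a b ∘ Fin.castAdd (n + 1) = a := funext (Fin.append_left a b)
  have h₂ : Fin.append a b ∘ Fin.natAdd (n + 1) = b := funext (Fin.append_right a b)
  change cls n (Fin.append a b ∘ Fin.castAdd (n + 1)) = cls n (Fin.append a b ∘ Fin.natAdd (n + 1))
    ↔ _
  rw [h₁, h₂]

theorem isEStructure_eStructure {B : Type} {γ : ℕ → Type} (cls : ∀ n, (Fin (n + 1) → B) → γ n)
    (h : ∀ n a b, ¬ Function.Injective a → (cls n a = cls n b ↔ ¬ Function.Injective b)) :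
    letI := eStructure cls
    IsEStructure B := by
  let _ := eStructure cls
  refine fun n => ⟨⟨fun a => ?_, fun {a b} => ?_, fun {a b c} => ?_⟩, fun a b => ?_⟩
  all_goals simp only [eRel_eStructure]
  · exact Eq.symm
  · exact Eq.trans
  · exact h n a b

theorem eRel_comp {A B : Type} [langE.Structure A] [langE.Structure B] (φ : A ↪[langE] B) {n : ℕ}
    (a b : Fin (n + 1) → A) : eRel (φ ∘ a) (φ ∘ b) ↔ eRel a b := by
  unfold eRel
  rw [← comp_append_fin]
  exact φ.map_rel (ERel.E n) _

/-- An injective map that preserves and reflects all `E_n`, as an embedding of `L_E`-structures. -/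
def eEmbedding {A B : Type} [langE.Structure A] [langE.Structure B] (f : A → B)
    (hf : Function.Injective f)
    (h : ∀ n (a b : Fin (n + 1) → A), eRel (f ∘ a) (f ∘ b) ↔ eRel a b) : A ↪[langE] B where
  toFun := f
  inj' := hf
  map_fun' g := isEmptyElim (α := Empty) g
  map_rel' := by
    rintro _ ⟨n⟩ x
    have happend : Fin.append (x ∘ Fin.castAdd (n + 1)) (x ∘ Fin.natAdd (n + 1)) = x :=
      Fin.append_castAdd_natAdd
    have hx := h n (x ∘ Fin.castAdd (n + 1)) (x ∘ Fin.natAdd (n + 1))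
    unfold eRel at hx
    rw [← comp_append_fin, happend] at hx
    exact hx

theorem IsEStructure.eProj_eq_iff {M : Type} [langE.Structure M] (hE : IsEStructure M) {n : ℕ}
    {a b : Fin (n + 1) → M} {ha : Function.Injective a} {hb : Function.Injective b} :
    eProj a ha = eProj b hb ↔ eRel a b := by
  have hequiv := (hE n).1
  exact Quot.eq.trans (Equivalence.eqvGen_iff (r := fun a b : {a : Fin (n + 1) → M //
    Function.Injective a} => eRel a.1 b.1)
    ⟨fun a => hequiv.refl _, fun h => hequiv.symm h, fun h h' => hequiv.trans h h'⟩)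

open Classical in
/-- The class of a tuple as an element of the sort; the tuples with a repeated coordinate, which
form a class without a name in the sort, are mapped to `none`. -/
noncomputable def eClass {M : Type} [langE.Structure M] {n : ℕ} (a : Fin (n + 1) → M) :
    Option (ESort n M) :=
  if h : Function.Injective a then some (eProj a h) else none

section EClass

variable {M : Type} [langE.Structure M] {n : ℕ} {a b : Fin (n + 1) → M}

theorem eClass_of_injective (h : Function.Injective a) : eClass a = some (eProj a h) :=
  dif_pos h

theorem eClass_eq_none_iff : eClass a = none ↔ ¬ Function.Injective a := by
  simp [eClass]

theorem isSome_eClass : (eClass a).isSome ↔ Function.Injective a := by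
  by_cases ha : Function.Injective a <;> simp [eClass, ha]

theorem eClass_eq_some_iff {σ : ESort n M} :
    eClass a = some σ ↔ ∃ h : Function.Injective a, eProj a h = σ := by
  simp [eClass]

theorem exists_eClass_eq_some (σ : ESort n M) : ∃ a : Fin (n + 1) → M, eClass a = some σ := by
  obtain ⟨⟨a, h⟩, rfl⟩ := Quot.exists_rep σ
  exact ⟨a, eClass_of_injective h⟩

theorem IsEStructure.eRel_iff (hE : IsEStructure M) : eRel a b ↔ eClass a = eClass b := by
  by_cases ha : Function.Injective a
  · by_cases hb : Function.Injective b
    · rw [eClass_of_injective ha, eClass_of_injective hb, Option.some_inj, hE.eProj_eq_iff]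
    · rw [eClass_eq_none_iff.2 hb, eClass_eq_none_iff, ← (hE n).2 b a hb]
      exact ⟨(hE n).1.symm, (hE n).1.symm⟩
  · rw [(hE n).2 a b ha, eClass_eq_none_iff.2 ha, eq_comm, eClass_eq_none_iff]

end EClass

section FraisseLimit

variable {M : Type} [langE.Structure M] [Countable M]

theorem nonempty_embedding_of_isFraisseLimit (hM : IsFraisseLimit classE M) {B : Type}
    [s : langE.Structure B] [Finite B] (hB : IsEStructure B) : Nonempty (B ↪[langE] M) := by
  have hage : (⟨B, s⟩ : CategoryTheory.Bundled langE.Structure) ∈ langE.age M := by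
    rw [hM.age]
    exact ⟨‹_›, hB⟩
  exact hage.2

theorem exists_lift_to_isEStructure (hM : IsFraisseLimit classE M) {n : ℕ}
    (a b c : Fin (n + 1) → M) :
    ∃ (B : Type) (_ : langE.Structure B) (φ : B ↪[langE] M), IsEStructure B ∧
      (∃ a', φ ∘ a' = a) ∧ (∃ b', φ ∘ b' = b) ∧ ∃ c', φ ∘ c' = c := by
  let s := Set.range a ∪ Set.range b ∪ Set.range c
  have hs : s.Finite :=
    ((Set.finite_range a).union (Set.finite_range b)).union (Set.finite_range c)
  have hage := age.fg_substructure (Substructure.fg_closure (L := langE) hs)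
  rw [hM.age] at hage
  have lift (d : Fin (n + 1) → M) (hd : Set.range d ⊆ s) :
      ∃ d' : Fin (n + 1) → Substructure.closure langE s, Substructure.subtype _ ∘ d' = d :=
    ⟨fun i => ⟨d i, Substructure.subset_closure (hd ⟨i, rfl⟩)⟩, rfl⟩
  exact ⟨_, inferInstance, Substructure.subtype _, hage.2,
    lift a (Set.subset_union_left.trans Set.subset_union_left),
    lift b (Set.subset_union_right.trans Set.subset_union_left), lift c Set.subset_union_right⟩

theorem isEStructure_of_isFraisseLimit (hM : IsFraisseLimit classE M) : IsEStructure M := by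
  refine fun n => ⟨⟨fun a => ?_, fun {a b} => ?_, fun {a b c} => ?_⟩, fun a b => ?_⟩
  · obtain ⟨B, _, φ, hB, ⟨a, rfl⟩, -⟩ := exists_lift_to_isEStructure hM a a a
    exact (eRel_comp φ a a).2 ((hB n).1.refl a)
  · obtain ⟨B, _, φ, hB, ⟨a, rfl⟩, ⟨b, rfl⟩, -⟩ := exists_lift_to_isEStructure hM a b b
    simpa only [eRel_comp] using (hB n).1.symm
  · obtain ⟨B, _, φ, hB, ⟨a, rfl⟩, ⟨b, rfl⟩, c, rfl⟩ := exists_lift_to_isEStructure hM a b c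
    simpa only [eRel_comp] using (hB n).1.trans
  · obtain ⟨B, _, φ, hB, ⟨a, rfl⟩, ⟨b, rfl⟩, -⟩ := exists_lift_to_isEStructure hM a b b
    simpa only [eRel_comp, φ.injective.of_comp_iff] using (hB n).2 a b

open Classical in
/-- The labels of the `L_E`-structure on `B` in which distinct tuples without repeated coordinates
are never equivalent. -/
noncomputable def discreteLabel {B : Type} (k : ℕ) (a : Fin (k + 1) → B) :
    Option (Fin (k + 1) → B) :=
  if Function.Injective a then some a else none

theorem infinite_eSort (hM : IsFraisseLimit classE M) (n : ℕ) : Infinite (ESort n M) := by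
  have hE := isEStructure_of_isFraisseLimit hM
  by_contra hfinite
  rw [not_infinite_iff_finite] at hfinite
  let B := Fin (n + 1) × Fin (Nat.card (ESort n M) + 1)
  let _ : langE.Structure B := eStructure discreteLabel
  have hB : IsEStructure B := isEStructure_eStructure discreteLabel fun k a b ha => by
    by_cases hb : Function.Injective b <;> simp [discreteLabel, ha, hb]
  obtain ⟨φ⟩ := nonempty_embedding_of_isFraisseLimit hM hB
  let a (j : Fin (Nat.card (ESort n M) + 1)) : Fin (n + 1) → B := fun i => (i, j)
  have ha j : Function.Injective (a j) := Prod.mk_left_injective j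
  have hinj : Function.Injective fun j => eProj (φ ∘ a j) (φ.injective.comp (ha j)) := by
    intro j j' h
    have hlabel := (eRel_comp φ _ _).1 (hE.eProj_eq_iff.1 h)
    rw [eRel_eStructure, discreteLabel, discreteLabel, if_pos (ha j), if_pos (ha j')] at hlabel
    exact congrArg Prod.snd (congrFun (Option.some_injective _ hlabel) 0)
  simpa using Nat.card_le_card_of_injective _ hinj

theorem exists_embedding_option (hM : IsFraisseLimit classE M) {Q : Set M} [Finite Q]
    [langE.Structure (Option Q)] (hQ : IsEStructure (Option Q))
    (h : ∀ n (a b : Fin (n + 1) → Q),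
      eRel (some ∘ a) (some ∘ b) ↔ eRel (Subtype.val ∘ a) (Subtype.val ∘ b)) :
    ∃ F : Option Q ↪[langE] M, ∀ q, F (some q) = q := by
  have hE := isEStructure_of_isFraisseLimit hM
  let _ : langE.Structure Q := eStructure fun _ a => eClass (Subtype.val ∘ a)
  have hval n (a b : Fin (n + 1) → Q) : eRel (Subtype.val ∘ a) (Subtype.val ∘ b) ↔ eRel a b := by
    rw [hE.eRel_iff, eRel_eStructure]
  obtain ⟨F, hF⟩ := hM.ultrahomogeneous.extend_embedding
    (Structure.fg_iff_finite.2 (inferInstance : Finite Q))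
    (eEmbedding Subtype.val Subtype.val_injective hval)
    (eEmbedding some (Option.some_injective Q) fun n a b => (h n a b).trans (hval n a b))
    (h := nonempty_embedding_of_isFraisseLimit hM hQ)
  exact ⟨F, fun q => (DFunLike.congr_fun hF q).symm⟩

end FraisseLimit

section BackAndForth

variable {M : Type} [langE.Structure M]

open Classical in
/-- The labels of an `L_E`-structure on `Option Q` that extends the one induced on `Q`; the classes
of the tuples through the new point `none` are prescribed by `σ`, and `m` is a dummy value. -/
noncomputable def extensionLabel {Q : Set M} (m : M)
    (σ : ∀ n, (Fin (n + 1) → Option Q) → Option (ESort n M)) (n : ℕ)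
    (t : Fin (n + 1) → Option Q) : Option (Option (ESort n M)) :=
  if none ∈ Set.range t then if Function.Injective t then some (σ n t) else none
  else (eClass fun i => (t i).elim m Subtype.val).map some

section ExtensionLabel

variable {Q : Set M} (m : M) (σ : ∀ n, (Fin (n + 1) → Option Q) → Option (ESort n M)) {n : ℕ}

theorem extensionLabel_some_comp (a : Fin (n + 1) → Q) :
    extensionLabel m σ n (some ∘ a) = (eClass (Subtype.val ∘ a)).map some :=
  if_neg (by simp)

theorem exists_some_comp_eq {A B : Type*} {t : A → Option B} (ht : none ∉ Set.range t) :
    ∃ a, some ∘ a = t := by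
  choose a ha using fun i => Option.ne_none_iff_exists.1 fun h => ht ⟨i, h⟩
  exact ⟨a, funext ha⟩

theorem extensionLabel_eq_none_iff (t : Fin (n + 1) → Option Q) :
    extensionLabel m σ n t = none ↔ ¬ Function.Injective t := by
  by_cases ht : none ∈ Set.range t
  · simp [extensionLabel, ht]
  · obtain ⟨a, rfl⟩ := exists_some_comp_eq ht
    rw [extensionLabel_some_comp, Option.map_eq_none_iff, eClass_eq_none_iff,
      Subtype.val_injective.of_comp_iff, (Option.some_injective _).of_comp_iff]

end ExtensionLabel

theorem exists_extension_eClass_eq [Countable M] (hM : IsFraisseLimit classE M) {Q : Set M}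
    [Finite Q] (m : M) (σ : ∀ n, (Fin (n + 1) → Option Q) → Option (ESort n M)) :
    ∃ F : Option Q → M, (∀ q, F (some q) = q) ∧
      ∀ n t (r : Fin (n + 1) → Q), Function.Injective t → none ∈ Set.range t →
        Function.Injective r → eClass (Subtype.val ∘ r) = σ n t → eClass (F ∘ t) = σ n t := by
  have hE := isEStructure_of_isFraisseLimit hM
  let _ : langE.Structure (Option Q) := eStructure (extensionLabel m σ)
  have hQ : IsEStructure (Option Q) := isEStructure_eStructure _ fun n a b ha => by
    rw [(extensionLabel_eq_none_iff m σ a).2 ha, eq_comm, extensionLabel_eq_none_iff]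
  obtain ⟨F, hF⟩ := exists_embedding_option hM hQ fun n a b => by
    rw [eRel_eStructure, extensionLabel_some_comp, extensionLabel_some_comp,
      (Option.map_injective (Option.some_injective _)).eq_iff, hE.eRel_iff]
  refine ⟨F, hF, fun n t r ht hnone hr h => ?_⟩
  have hval : F ∘ some ∘ r = Subtype.val ∘ r := funext fun i => hF (r i)
  have hlabel : extensionLabel m σ n t = extensionLabel m σ n (some ∘ r) := by
    rw [extensionLabel_some_comp, h, extensionLabel, if_pos hnone, if_pos ht, ← h,
      eClass_of_injective (Subtype.val_injective.comp hr), Option.map_some]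
  rw [← h, ← hval, ← hE.eRel_iff, eRel_comp, eRel_eStructure, hlabel]

theorem exists_finite_representatives {s : Set M} (hs : s.Finite)
    (f : ∀ n, ESort n M → ESort n M) :
    ∃ Q : Set M, Q.Finite ∧ ∀ n (a : Fin (n + 1) → M), Function.Injective a → (∀ i, a i ∈ s) →
      ∃ r : Fin (n + 1) → M, (∀ i, r i ∈ Q) ∧ eClass r = (eClass a).map (f n) := by
  choose rep hrep using fun n => exists_eClass_eq_some (M := M) (n := n)
  have : Finite s := hs
  let ι := Σ n : Fin (Nat.card s), {a : Fin (n + 1) → s // Function.Injective a}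
  let r (j : ι) : Fin (j.1 + 1) → M :=
    rep j.1 (f j.1 (eProj _ (Subtype.val_injective.comp j.2.2)))
  refine ⟨⋃ j, Set.range (r j), Set.finite_iUnion fun j => Set.finite_range _,
    fun n a ha hmem => ?_⟩
  let a' (i : Fin (n + 1)) : s := ⟨a i, hmem i⟩
  have ha' : Function.Injective a' := fun i j h => ha (congrArg Subtype.val h)
  have hn : n < Nat.card s := by simpa using Nat.card_le_card_of_injective _ ha'
  let j : ι := ⟨⟨n, hn⟩, a', ha'⟩
  refine ⟨r j, fun i => Set.mem_iUnion_of_mem j (Set.mem_range_self i), ?_⟩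
  rw [eClass_of_injective ha, Option.map_some]
  exact hrep n _

/-- A set of pairs is a partial lift of a family of permutations of the sorts if it maps the class
of every tuple as prescribed by the family. -/
def IsPartialLift (f : ∀ n, Equiv.Perm (ESort n M)) (p : Set (M × M)) : Prop :=
  ∀ n (t : Fin (n + 1) → M × M), (∀ i, t i ∈ p) →
    eClass (Prod.snd ∘ t) = (eClass (Prod.fst ∘ t)).map (f n)

namespace IsPartialLift

variable {f : ∀ n, Equiv.Perm (ESort n M)} {p : Set (M × M)}

theorem injective_iff (hp : IsPartialLift f p) {n : ℕ} {t : Fin (n + 1) → M × M}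
    (ht : ∀ i, t i ∈ p) :
    Function.Injective (Prod.snd ∘ t) ↔ Function.Injective (Prod.fst ∘ t) := by
  rw [← not_iff_not, ← eClass_eq_none_iff, ← eClass_eq_none_iff, hp n t ht, Option.map_eq_none_iff]

theorem fst_eq_iff (hp : IsPartialLift f p) {a b : M × M} (ha : a ∈ p) (hb : b ∈ p) :
    a.1 = b.1 ↔ a.2 = b.2 := by
  have h := hp.injective_iff (n := 1) (t := ![a, b]) (Fin.forall_fin_two.2 ⟨ha, hb⟩)
  rw [← not_iff_not]
  simpa [Function.Injective, Fin.forall_fin_two, eq_comm, imp_false] using h.symm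

theorem symm (hp : IsPartialLift f p) :
    IsPartialLift (fun n => (f n).symm) (Prod.swap ⁻¹' p) := fun n t ht => by
  have h := hp n (Prod.swap ∘ t) ht
  change eClass (Prod.fst ∘ t) = (eClass (Prod.snd ∘ t)).map (f n) at h
  change eClass (Prod.snd ∘ t) = _
  rw [h, Option.map_map, (f n).symm_comp_self, Option.map_id, id]

theorem exists_image [Countable M] (hM : IsFraisseLimit classE M) (hp : IsPartialLift f p)
    (hfin : p.Finite) (m : M) :
    ∃ m', ∀ n (t : Fin (n + 1) → M × M), (∀ i, t i ∈ insert (m, m') p) →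
      Function.Injective (Prod.fst ∘ t) →
      eClass (Prod.snd ∘ t) = (eClass (Prod.fst ∘ t)).map (f n) := by
  obtain ⟨Q₀, hQ₀, hrep⟩ :=
    exists_finite_representatives ((hfin.image Prod.fst).insert m) fun n => f n
  let Q : Set M := Prod.snd '' p ∪ Q₀
  have : Finite Q := ((hfin.image Prod.snd).union hQ₀).to_subtype
  have : Nonempty (M × M) := ⟨(m, m)⟩
  let u (o : Option Q) : M := o.elim m fun q => (Function.invFunOn Prod.snd p q).1
  obtain ⟨F, hFval, hFclass⟩ :=
    exists_extension_eClass_eq hM (Q := Q) m fun n t => (eClass (u ∘ t)).map (f n)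
  have hcoord (a : M × M) (ha : a ∈ insert (m, F none) p) :
      ∃ o, u o = a.1 ∧ F o = a.2 ∧ (o = none ∨ a ∈ p) := by
    obtain rfl | ha := ha
    · exact ⟨none, rfl, rfl, Or.inl rfl⟩
    · have hex : ∃ b ∈ p, b.2 = a.2 := ⟨a, ha, rfl⟩
      exact ⟨some ⟨a.2, Or.inl ⟨a, ha, rfl⟩⟩,
        (hp.fst_eq_iff (Function.invFunOn_mem hex) ha).2 (Function.invFunOn_eq hex),
        hFval _, Or.inr ha⟩
  refine ⟨F none, fun n t ht hinj => ?_⟩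
  by_cases hold : ∀ i, t i ∈ p
  · exact hp n t hold
  push Not at hold
  obtain ⟨i, hi⟩ := hold
  choose o hu hFo hnone using fun i => hcoord (t i) (ht i)
  replace hu : u ∘ o = Prod.fst ∘ t := funext hu
  replace hFo : F ∘ o = Prod.snd ∘ t := funext hFo
  obtain ⟨r, hrQ, hr⟩ := hrep n (Prod.fst ∘ t) hinj fun i =>
    (ht i).imp (congrArg Prod.fst) (Set.mem_image_of_mem Prod.fst)
  have hrinj : Function.Injective r := not_not.1 <| eClass_eq_none_iff.not.1 <| by
    simp [hr, eClass_of_injective hinj]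
  rw [← hFo, ← hu]
  refine hFclass n o (fun i => ⟨r i, Or.inr (hrQ i)⟩) (hu ▸ hinj).of_comp
    ⟨i, (hnone i).resolve_right hi⟩ (fun i j h => hrinj (congrArg Subtype.val h)) ?_
  rw [hu]
  exact hr

theorem exists_extension [Countable M] (hM : IsFraisseLimit classE M) (hp : IsPartialLift f p)
    (hfin : p.Finite) (m : M) :
    ∃ p', p ⊆ p' ∧ p'.Finite ∧ IsPartialLift f p' ∧ ∃ m', (m, m') ∈ p' := by
  by_cases hm : ∃ m', (m, m') ∈ p
  · exact ⟨p, subset_rfl, hfin, hp, hm⟩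
  obtain ⟨m', hm'⟩ := hp.exists_image hM hfin m
  have hfunc {a b : M × M} (ha : a ∈ insert (m, m') p) (hb : b ∈ insert (m, m') p)
      (hab : a.1 = b.1) : a.2 = b.2 := by
    obtain rfl | ha := ha <;> obtain rfl | hb := hb
    · rfl
    · exact absurd ⟨b.2, by rwa [show m = b.1 from hab]⟩ hm
    · exact absurd ⟨a.2, by rwa [← show a.1 = m from hab]⟩ hm
    · exact (hp.fst_eq_iff ha hb).1 hab
  refine ⟨insert (m, m') p, Set.subset_insert _ _, hfin.insert _, fun n t ht => ?_,
    m', Set.mem_insert _ _⟩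
  by_cases hinj : Function.Injective (Prod.fst ∘ t)
  · exact hm' n t ht hinj
  · rw [eClass_eq_none_iff.2 hinj, Option.map_none, eClass_eq_none_iff]
    exact fun h => hinj fun i j hij => h (hfunc (ht i) (ht j) hij)

end IsPartialLift

theorem exists_perm_eClass_comp [Countable M] (hM : IsFraisseLimit classE M)
    (f : ∀ n, Equiv.Perm (ESort n M)) :
    ∃ g : Equiv.Perm M, ∀ n (a : Fin (n + 1) → M), eClass (g ∘ a) = (eClass a).map (f n) := by
  let _ := Encodable.ofCountable M
  let P := {p : Set (M × M) // p.Finite ∧ IsPartialLift f p}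
  let toDefine (m : M) : Order.Cofinal P := ⟨{p | ∃ m', (m, m') ∈ p.1}, fun p => by
    obtain ⟨p', hle, hfin, hp', hm⟩ := p.2.2.exists_extension hM p.2.1 m
    exact ⟨⟨p', hfin, hp'⟩, hm, hle⟩⟩
  let toHit (m' : M) : Order.Cofinal P := ⟨{p | ∃ m, (m, m') ∈ p.1}, fun p => by
    obtain ⟨p', hle, hfin, hp', m, hm⟩ := p.2.2.symm.exists_extension hM
      (p.2.1.preimage Prod.swap_injective.injOn) m'
    exact ⟨⟨Prod.swap ⁻¹' p', hfin.preimage Prod.swap_injective.injOn, hp'.symm⟩, ⟨m, hm⟩,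
      fun a ha => hle (by simpa using ha)⟩⟩
  let p₀ : P := ⟨∅, Set.finite_empty, fun n t ht => absurd (ht 0) (Set.notMem_empty _)⟩
  let 𝒟 : M ⊕ M → Order.Cofinal P := Sum.elim toDefine toHit
  let S : ℕ → P := Order.sequenceOfCofinals p₀ 𝒟
  have hmono : Monotone S := Order.sequenceOfCofinals.monotone p₀ 𝒟
  have hS {k l : ℕ} (h : k ≤ l) {a : M × M} : a ∈ (S k).1 → a ∈ (S l).1 := fun ha => hmono h ha
  have hdefine (m : M) : ∃ m' k, (m, m') ∈ (S k).1 :=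
    (Order.sequenceOfCofinals.encode_mem p₀ 𝒟 (Sum.inl m)).imp fun _ h => ⟨_, h⟩
  have hhit (m' : M) : ∃ m k, (m, m') ∈ (S k).1 :=
    (Order.sequenceOfCofinals.encode_mem p₀ 𝒟 (Sum.inr m')).imp fun _ h => ⟨_, h⟩
  have hbij {k l : ℕ} {a b : M × M} (ha : a ∈ (S k).1) (hb : b ∈ (S l).1) :
      a.1 = b.1 ↔ a.2 = b.2 :=
    (S (max k l)).2.2.fst_eq_iff (hS (le_max_left _ _) ha) (hS (le_max_right _ _) hb)
  choose g k hg using hdefine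
  have hgbij : Function.Bijective g := by
    refine ⟨fun x y hxy => (hbij (hg x) (hg y)).2 hxy, fun y => ?_⟩
    obtain ⟨x, l, hx⟩ := hhit y
    exact ⟨x, (hbij (hg x) hx).1 rfl⟩
  refine ⟨Equiv.ofBijective g hgbij, fun n a => ?_⟩
  exact (S (Finset.univ.sup (k ∘ a))).2.2 n (fun i => (a i, g (a i))) fun i =>
    hS (Finset.le_sup (f := k ∘ a) (Finset.mem_univ i)) (hg (a i))

end BackAndForth

/-! ### Orbits that are canonical pieces -/

theorem smul_mem_saturation_iff {G X : Type*} [Group G] [MulAction G X] {A : Set X} (g : G)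
    {x : X} : g • x ∈ saturation G A ↔ x ∈ saturation G A := by
  constructor
  · rintro ⟨h, a, ha, hx⟩
    exact ⟨g⁻¹ * h, a, ha, by rw [mul_smul, hx, inv_smul_smul]⟩
  · rintro ⟨h, a, ha, rfl⟩
    exact ⟨g * h, a, ha, mul_smul _ _ _⟩

theorem isCanonicalPiece_orbit {G X ι : Type*} [Group G] [MulAction G X] (A : ι → Set X) (x : X)
    (h : ∀ y, (∀ j, y ∈ saturation G (A j) ↔ x ∈ saturation G (A j)) → y ∈ MulAction.orbit G x) :
    IsCanonicalPiece G A (MulAction.orbit G x) := by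
  classical
  refine ⟨⟨x, MulAction.mem_orbit_self x⟩, fun j => decide (x ∈ saturation G (A j)), ?_⟩
  ext y
  simp only [Set.mem_inter_iff, Set.mem_iInter, Set.mem_ofPred_eq, decide_eq_true_eq,
    decide_eq_false_iff_not, Set.mem_compl_iff]
  constructor
  · rintro ⟨g, rfl⟩
    exact ⟨fun j => (smul_mem_saturation_iff g).2, fun j => mt (smul_mem_saturation_iff g).1⟩
  · rintro ⟨hmem, hnotMem⟩
    exact h y fun j => ⟨fun hy => by_contra fun hx => hnotMem j hx hy, hmem j⟩

section Expansions

variable {LN : FirstOrder.Language.{0, 0}} {N : Type} [LN.Structure N] [langE.Structure ℕ]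
  [LN.Structure ℕ]

theorem expansions_ext {x y : Expansions LN N} (h : ∀ n i a, pRel x.1 n i a ↔ pRel y.1 n i a) :
    x = y := by
  apply Subtype.ext
  apply Structure.ext
  · funext n f
    exact f.elim
  · funext k (R : PRel k) a
    cases R with
    | P n i => exact propext (h n i a)

theorem pRel_smul (g : autGroup (langZero LN)) (x : Expansions LN N) {n i : ℕ}
    {a : Fin (n + 2) → ℕ} : pRel (g • x).1 n i a ↔ pRel x.1 n i (g.1.symm ∘ a) :=
  Iff.rfl

theorem pRel_smul_comp (g : autGroup (langZero LN)) (x : Expansions LN N) {n i : ℕ}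
    {a : Fin (n + 2) → ℕ} : pRel (g • x).1 n i (g.1 ∘ a) ↔ pRel x.1 n i a := by
  rw [pRel_smul, ← Function.comp_assoc, Equiv.symm_comp_self, Function.id_comp]

theorem eRel_comp_autGroup (g : autGroup (langZero LN)) {n : ℕ} (a b : Fin (n + 1) → ℕ) :
    eRel (g.1 ∘ a) (g.1 ∘ b) ↔ eRel a b := by
  unfold eRel
  rw [← comp_append_fin]
  exact g.2.2 _ (Sum.inl (ERel.E n)) _

theorem mem_saturation_basicSet {x : Expansions LN N} {D : DiagramCode} :
    x ∈ saturation (autGroup (langZero LN)) (basicSet D) ↔ ∃ g : autGroup (langZero LN),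
      ∀ p ∈ D.2.1, ∀ b : Fin (p.1 + 2) → ℕ, (∀ j, b j ∈ D.1) →
        (pRel x.1 p.1 p.2 (g.1 ∘ b) ↔ (p, List.ofFn b) ∈ D.2.2) := by
  constructor
  · rintro ⟨g, y, hy, rfl⟩
    exact ⟨g, fun p hp b hb => (pRel_smul_comp g y).trans (hy p hp b hb)⟩
  · rintro ⟨g, hg⟩
    refine ⟨g, g⁻¹ • x, fun p hp b hb => ?_, smul_inv_smul g x⟩
    rw [← hg p hp b hb, ← pRel_smul_comp g (g⁻¹ • x), smul_inv_smul]

theorem exists_facts (y : Expansions LN N) (L : List ℕ) (p : ℕ × ℕ) :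
    ∃ F : List ((ℕ × ℕ) × List ℕ), ∀ b : Fin (p.1 + 2) → ℕ, (∀ j, b j ∈ L) →
      (pRel y.1 p.1 p.2 b ↔ (p, List.ofFn b) ∈ F) := by
  classical
  refine ⟨((tuplesFrom L (p.1 + 2)).filter fun l =>
    ∃ b, List.ofFn b = l ∧ pRel y.1 p.1 p.2 b).map fun l => (p, l), fun b hb => ?_⟩
  have hL : List.ofFn b ∈ tuplesFrom L (p.1 + 2) :=
    mem_tuplesFrom.2 ⟨List.length_ofFn, List.forall_mem_ofFn_iff.2 hb⟩
  simp only [List.mem_map, List.mem_filter, decide_eq_true_eq, Prod.mk.injEq, true_and,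
    exists_eq_right, hL]
  constructor
  · exact fun h => ⟨b, rfl, h⟩
  · rintro ⟨b', h, h'⟩
    rwa [← List.ofFn_injective h]

theorem exists_autGroup_pRel_iff {x y : Expansions LN N}
    (h : ∀ D, y ∈ saturation (autGroup (langZero LN)) (basicSet D) →
      x ∈ saturation (autGroup (langZero LN)) (basicSet D)) (L : List ℕ) (n i : ℕ) :
    ∃ g : autGroup (langZero LN), ∀ b : Fin (n + 2) → ℕ, (∀ j, b j ∈ L) →
      (pRel x.1 n i (g.1 ∘ b) ↔ pRel y.1 n i b) := by
  obtain ⟨F, hF⟩ := exists_facts y L (n, i)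
  have hy : y ∈ saturation (autGroup (langZero LN)) (basicSet (L, [(n, i)], F)) := by
    refine mem_saturation_basicSet.2 ⟨1, fun p hp b hb => ?_⟩
    obtain rfl := List.mem_singleton.1 hp
    exact hF b hb
  obtain ⟨g, hg⟩ := mem_saturation_basicSet.1 (h _ hy)
  exact ⟨g, fun b hb => (hg (n, i) (List.mem_singleton_self _) b hb).trans (hF b hb).symm⟩

/-- The expansion in which the new symbols are interpreted by the given sets of classes. -/
def expansionOf (hM : IsBaseStructure LN N ℕ) (U : ∀ n, ℕ → Set (ESort (n + 1) ℕ)) :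
    Expansions LN N :=
  letI x : langP.Structure ℕ :=
    { funMap := fun f => isEmptyElim (α := Empty) f
      RelMap := fun {k} (R : PRel k) => match k, R with
        | _, PRel.P n i => fun a => ∃ h : Function.Injective a, eProj a h ∈ U n i }
  ⟨x, ⟨fun _ hφ => hφ ℕ ⟨hM, U, fun _ _ _ => Iff.rfl⟩⟩⟩

theorem pRel_expansionOf (hM : IsBaseStructure LN N ℕ) (U : ∀ n, ℕ → Set (ESort (n + 1) ℕ))
    (n i : ℕ) (a : Fin (n + 2) → ℕ) :
    pRel (expansionOf hM U).1 n i a ↔ ∃ s ∈ U n i, eClass (n := n + 1) a = some s := by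
  change (∃ h : Function.Injective a, eProj (n := n + 1) a h ∈ U n i) ↔ _
  simp only [eClass_eq_some_iff]
  constructor
  · rintro ⟨h, hs⟩
    exact ⟨_, hs, h, rfl⟩
  · rintro ⟨_, hs, h, rfl⟩
    exact ⟨h, hs⟩

/-- The invariant expansion that encodes the set `D`: the `i`-th binary symbol holds of all pairs
of distinct elements if `i ∈ D`, and all other new symbols are empty. -/
def fullExpansion (hM : IsBaseStructure LN N ℕ) (D : Set ℕ) : Expansions LN N :=
  expansionOf hM fun n i => {_s | n = 0 ∧ i ∈ D}

theorem pRel_fullExpansion (hM : IsBaseStructure LN N ℕ) {D : Set ℕ} {n i : ℕ}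
    {a : Fin (n + 2) → ℕ} :
    pRel (fullExpansion hM D).1 n i a ↔ Function.Injective a ∧ n = 0 ∧ i ∈ D := by
  rw [fullExpansion, pRel_expansionOf, ← isSome_eClass, Option.isSome_iff_exists,
    ← exists_and_right]
  exact exists_congr fun s => and_comm

theorem orbit_fullExpansion (hM : IsBaseStructure LN N ℕ) (D : Set ℕ) :
    MulAction.orbit (autGroup (langZero LN)) (fullExpansion hM D) = {fullExpansion hM D} := by
  refine (Set.eq_singleton_iff_unique_mem).2 ⟨MulAction.mem_orbit_self _, ?_⟩
  rintro _ ⟨g, rfl⟩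
  exact expansions_ext fun n i a => by
    rw [pRel_smul, pRel_fullExpansion, pRel_fullExpansion, g.1.symm.injective.of_comp_iff]

theorem isCanonicalPiece_fullExpansion (hM : IsBaseStructure LN N ℕ) (D : Set ℕ) :
    IsCanonicalPiece (autGroup (langZero LN)) basicSet
      (MulAction.orbit (autGroup (langZero LN)) (fullExpansion hM D)) := by
  refine isCanonicalPiece_orbit _ _ fun y hy => ?_
  rw [orbit_fullExpansion]
  refine expansions_ext fun n i a => ?_
  obtain ⟨g, hg⟩ := exists_autGroup_pRel_iff (fun D => (hy D).1) (List.ofFn a) n i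
  rw [← hg a fun j => List.mem_ofFn.2 ⟨j, rfl⟩, pRel_fullExpansion, pRel_fullExpansion,
    g.1.injective.of_comp_iff]

/-- The expansion in which the first symbol of arity `n + 2` is interpreted by the class `c n`,
if there is one, and all other new symbols are empty. -/
def classExpansion (hM : IsBaseStructure LN N ℕ) (c : ∀ n, Option (ESort (n + 1) ℕ)) :
    Expansions LN N :=
  expansionOf hM fun n i => {s | i = 0 ∧ c n = some s}

theorem pRel_classExpansion_iff_exists (hM : IsBaseStructure LN N ℕ)
    {c : ∀ n, Option (ESort (n + 1) ℕ)} {n i : ℕ} {a : Fin (n + 2) → ℕ} :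
    pRel (classExpansion hM c).1 n i a ↔
      ∃ s, (i = 0 ∧ c n = some s) ∧ eClass (n := n + 1) a = some s :=
  pRel_expansionOf hM _ n i a

theorem pRel_classExpansion (hM : IsBaseStructure LN N ℕ) {c : ∀ n, Option (ESort (n + 1) ℕ)}
    {n i : ℕ} {a : Fin (n + 2) → ℕ} :
    pRel (classExpansion hM c).1 n i a ↔ i = 0 ∧ (c n).isSome ∧ eClass (n := n + 1) a = c n := by
  rw [pRel_classExpansion_iff_exists, Option.isSome_iff_exists, ← exists_and_right,
    ← exists_and_left]
  refine exists_congr fun s => ?_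
  rw [and_assoc]
  exact and_congr_right fun _ => and_congr_right fun h => by rw [h]

theorem exists_autGroup_eClass_comp [LN.IsRelational] (hM : IsBaseStructure LN N ℕ)
    (f : ∀ n, Equiv.Perm (ESort (n + 1) ℕ)) :
    ∃ g : autGroup (langZero LN), ∀ n (a : Fin (n + 2) → ℕ),
      eClass (n := n + 1) (g.1 ∘ a) = (eClass (n := n + 1) a).map (f n) := by
  -- The `E_1`-classes are fixed, since the structure on the sort of `E_1`-classes is arbitrary.
  let f' (n : ℕ) : Equiv.Perm (ESort n ℕ) := match n with
    | 0 => 1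
    | n + 1 => f n
  obtain ⟨g, hg⟩ := exists_perm_eClass_comp hM.1 f'
  have hE := isEStructure_of_isFraisseLimit hM.1
  obtain ⟨S, -, hS⟩ := hM.2
  have heRel {n : ℕ} (a b : Fin (n + 1) → ℕ) : eRel (g ∘ a) (g ∘ b) ↔ eRel a b := by
    rw [hE.eRel_iff, hE.eRel_iff, hg, hg, (Option.map_injective (f' n).injective).eq_iff]
  have hone (m : ℕ) : eClass (fun _ : Fin (0 + 1) => m) = some (eProjOne m) :=
    eClass_of_injective _
  have hfix (m : ℕ) : eProjOne (g m) = eProjOne m := by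
    have h := hg 0 fun _ => m
    rw [hone] at h
    exact Option.some_injective _ ((hone (g m)).symm.trans h)
  refine ⟨⟨g, fun n φ => isEmptyElim φ, fun n R a => ?_⟩, fun n => hg (n + 1)⟩
  rcases R with R | R
  · obtain ⟨n⟩ : ERel n := R
    exact (eEmbedding g g.injective fun n => heRel).map_rel (ERel.E _) a
  · have hR : Structure.RelMap R (g ∘ a) ↔ Structure.RelMap R a := by
      simp only [hS, Function.comp_apply, hfix]
    exact hR

theorem classExpansion_mem_orbit [LN.IsRelational] (hM : IsBaseStructure LN N ℕ)
    {c c' : ∀ n, Option (ESort (n + 1) ℕ)} (h : ∀ n, (c n).isSome = (c' n).isSome) :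
    classExpansion hM c' ∈
      MulAction.orbit (autGroup (langZero LN)) (classExpansion hM c) := by
  classical
  have hperm n : ∃ f : Equiv.Perm (ESort (n + 1) ℕ), c' n = (c n).map f := by
    match hc : c n, hc' : c' n with
    | none, none => exact ⟨1, rfl⟩
    | some s, some s' => exact ⟨Equiv.swap s s', by simp⟩
    | none, some s' => simpa [hc, hc'] using h n
    | some s, none => simpa [hc, hc'] using h n
  choose f hf using hperm
  obtain ⟨g, hg⟩ := exists_autGroup_eClass_comp hM f
  refine ⟨g, expansions_ext fun n i a => ?_⟩
  obtain ⟨a, rfl⟩ := g.1.surjective.comp_left a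
  refine (pRel_smul_comp g _).trans ?_
  rw [pRel_classExpansion, pRel_classExpansion, hg, h n, hf n,
    (Option.map_injective (f n).injective).eq_iff]

/-- The set of the `n` for which the first symbol of arity `n + 2` is not empty. -/
def support (x : Expansions LN N) : Set ℕ :=
  {n | ∃ a, pRel x.1 n 0 a}

theorem mem_support_classExpansion (hM : IsBaseStructure LN N ℕ)
    {c : ∀ n, Option (ESort (n + 1) ℕ)} {n : ℕ} :
    n ∈ support (classExpansion hM c) ↔ (c n).isSome := by
  constructor
  · rintro ⟨a, ha⟩
    exact ((pRel_classExpansion hM).1 ha).2.1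
  · intro h
    obtain ⟨s, hs⟩ := Option.isSome_iff_exists.1 h
    obtain ⟨a, ha⟩ := exists_eClass_eq_some s
    exact ⟨a, (pRel_classExpansion hM).2 ⟨rfl, h, ha.trans hs.symm⟩⟩

theorem support_subset {x y : Expansions LN N}
    (h : ∀ D, y ∈ saturation (autGroup (langZero LN)) (basicSet D) →
      x ∈ saturation (autGroup (langZero LN)) (basicSet D)) : support y ⊆ support x := by
  rintro n ⟨a, ha⟩
  obtain ⟨g, hg⟩ := exists_autGroup_pRel_iff h (List.ofFn a) n 0
  exact ⟨_, (hg a fun j => List.mem_ofFn.2 ⟨j, rfl⟩).2 ha⟩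

theorem exists_eq_classExpansion (hM : IsBaseStructure LN N ℕ) {y : Expansions LN N}
    (hinj : ∀ n i a, pRel y.1 n i a → i = 0 ∧ Function.Injective a)
    (hclass : ∀ n a b, pRel y.1 n 0 a → (pRel y.1 n 0 b ↔ eRel (n := n + 1) a b)) :
    ∃ c, y = classExpansion hM c := by
  classical
  refine ⟨fun n => if h : n ∈ support y then eClass (n := n + 1) h.choose else none,
    expansions_ext fun n i a => ?_⟩
  rw [pRel_classExpansion]
  by_cases hn : n ∈ support y
  · rw [dif_pos hn, isSome_eClass, eq_comm (b := eClass _),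
      ← (isEStructure_of_isFraisseLimit hM.1).eRel_iff, ← hclass n _ a hn.choose_spec]
    constructor
    · intro ha
      obtain ⟨rfl, -⟩ := hinj n i a ha
      exact ⟨rfl, (hinj n 0 _ hn.choose_spec).2, ha⟩
    · rintro ⟨rfl, -, ha⟩
      exact ha
  · refine iff_of_false (fun ha => hn ?_) (by simp [hn])
    obtain ⟨rfl, -⟩ := hinj n i a ha
    exact ⟨a, ha⟩

theorem isCanonicalPiece_classExpansion [LN.IsRelational] (hM : IsBaseStructure LN N ℕ)
    (c : ∀ n, Option (ESort (n + 1) ℕ)) :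
    IsCanonicalPiece (autGroup (langZero LN)) basicSet
      (MulAction.orbit (autGroup (langZero LN)) (classExpansion hM c)) := by
  refine isCanonicalPiece_orbit _ _ fun y hy => ?_
  have hE := isEStructure_of_isFraisseLimit hM.1
  have transfer := exists_autGroup_pRel_iff fun D => (hy D).1
  obtain ⟨c', rfl⟩ := exists_eq_classExpansion hM (y := y)
    (fun n i a ha => by
      obtain ⟨g, hg⟩ := transfer (List.ofFn a) n i
      rw [← hg a fun j => List.mem_ofFn.2 ⟨j, rfl⟩, pRel_classExpansion] at ha
      obtain ⟨hi, hsome, hclass⟩ := ha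
      rw [← hclass, isSome_eClass] at hsome
      exact ⟨hi, hsome.of_comp⟩)
    (fun n a b ha => by
      obtain ⟨g, hg⟩ := transfer (List.ofFn a ++ List.ofFn b) n 0
      rw [← hg a fun j => List.mem_append_left _ (List.mem_ofFn.2 ⟨j, rfl⟩),
        pRel_classExpansion] at ha
      obtain ⟨-, hsome, hclass⟩ := ha
      rw [← hg b fun j => List.mem_append_right _ (List.mem_ofFn.2 ⟨j, rfl⟩),
        pRel_classExpansion, ← eRel_comp_autGroup g, hE.eRel_iff, hclass, eq_comm (a := c n)]
      simp [hsome])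
  refine classExpansion_mem_orbit hM fun n => ?_
  rw [Bool.eq_iff_iff, ← mem_support_classExpansion hM, ← mem_support_classExpansion hM]
  exact ⟨fun h => support_subset (fun D => (hy D).2) h,
    fun h => support_subset (fun D => (hy D).1) h⟩

theorem support_eq_of_mem_orbit {x y : Expansions LN N}
    (h : y ∈ MulAction.orbit (autGroup (langZero LN)) x) : support y = support x := by
  obtain ⟨g, rfl⟩ := h
  exact (support_subset fun D => (smul_mem_saturation_iff g).1).antisymm
    (support_subset fun D => (smul_mem_saturation_iff g).2)

end Expansions

/-- The truth values of atomic facts in `fullExpansion hM D`, computed from an initial segment of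
the characteristic function of `D`. -/
def fullFacts (s : List ℕ) (r : (ℕ × ℕ) × List ℕ) : Bool :=
  decide r.2.Nodup && (decide (r.1.1 = 0) && decide (s[r.1.2]? = some 1))

theorem primrec₂_fullFacts : Primrec₂ fullFacts := by
  have hsymbol : Primrec fun t : List ℕ × (ℕ × ℕ) × List ℕ => t.2.1 :=
    Primrec.fst.comp Primrec.snd
  exact Primrec.and.comp (primrec_list_nodup.comp (Primrec.snd.comp Primrec.snd))
    (Primrec.and.comp (Primrec.eq.decide.comp (Primrec.fst.comp hsymbol) (Primrec.const 0))
      (Primrec.eq.decide.comp (Primrec.list_getElem?.comp Primrec.fst (Primrec.snd.comp hsymbol))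
        (Primrec.const (some 1))))

/-- A bound for the indices of the symbols in the diagram with the given code. -/
def symbolBound (m : ℕ) : ℕ :=
  ((Denumerable.ofNat DiagramCode m).2.1.map fun p => p.2 + 1).sum

theorem primrec_symbolBound : Primrec symbolBound :=
  Primrec.list_foldr (h := fun _ (t : ℕ × ℕ) => t.1 + t.2)
    (Primrec.list_map (f := fun m => (Denumerable.ofNat DiagramCode m).2.1)
      (g := fun _ p => p.2 + 1) (Primrec.fst.comp (Primrec.snd.comp (Primrec.ofNat DiagramCode)))
      (Primrec.succ.comp (Primrec.snd.comp Primrec.snd))) (Primrec.const 0)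
    (Primrec.nat_add.comp (Primrec.fst.comp Primrec.snd) (Primrec.snd.comp Primrec.snd))

theorem lt_symbolBound {m : ℕ} {p : ℕ × ℕ} (hp : p ∈ (Denumerable.ofNat DiagramCode m).2.1) :
    p.2 < symbolBound m :=
  List.le_sum_of_mem (List.mem_map_of_mem (f := fun p : ℕ × ℕ => p.2 + 1) hp)

section FullExpansion

variable {LN : FirstOrder.Language.{0, 0}} {N : Type} [LN.Structure N] [langE.Structure ℕ]
  [LN.Structure ℕ]

theorem mem_iff_notMem_satSet_fullExpansion (hM : IsBaseStructure LN N ℕ) {D : Set ℕ} {i : ℕ} :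
    i ∈ D ↔ Encodable.encode (([0, 1], [(0, i)], []) : DiagramCode) ∉
      satSet (fullExpansion hM D) := by
  simp only [encode_mem_satSet_iff, mem_basicSet_nil_iff, not_forall, not_not, pRel_fullExpansion,
    true_and]
  constructor
  · exact fun hi => ⟨![0, 1], by simp [Fin.forall_fin_two], by decide, hi⟩
  · rintro ⟨-, -, -, hi⟩
    exact hi

theorem setTuringReducible_satSet_fullExpansion (hM : IsBaseStructure LN N ℕ) (D : Set ℕ) :
    SetTuringReducible D (satSet (fullExpansion hM D)) := by
  have hcode : Primrec fun i : ℕ =>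
      Encodable.encode (([0, 1], [(0, i)], []) : DiagramCode) :=
    Primrec.encode.comp (Primrec.pair (Primrec.const [0, 1]) (Primrec.pair
      (Primrec.list_cons.comp (Primrec.pair (Primrec.const 0) Primrec.id)
        (Primrec.const ([] : List (ℕ × ℕ)))) (Primrec.const [])))
  exact .of_notMem hcode.to_comp fun i => mem_iff_notMem_satSet_fullExpansion hM

theorem fullFacts_iff (hM : IsBaseStructure LN N ℕ) {D : Set ℕ} {m : ℕ} {p : ℕ × ℕ} (hp : p.2 < m)
    (b : Fin (p.1 + 2) → ℕ) :
    fullFacts (initialSegment (charNat D) m) (p, List.ofFn b) = true ↔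
      pRel (fullExpansion hM D).1 p.1 p.2 b := by
  have hD : charNat D p.2 = 1 ↔ p.2 ∈ D := by simp [charNat]
  simp only [fullFacts, pRel_fullExpansion, getElem?_initialSegment, if_pos hp, Bool.and_eq_true,
    decide_eq_true_eq, List.nodup_ofFn, Option.some.injEq, hD]

theorem satSet_fullExpansion_setTuringReducible (hM : IsBaseStructure LN N ℕ) (D : Set ℕ) :
    SetTuringReducible (satSet (fullExpansion hM D)) D :=
  .of_initialSegment (computable₂_satFun primrec₂_fullFacts.to_comp) primrec_symbolBound.to_comp
    fun _ => charNat_satSet_eq_satFun fun _ hp b => fullFacts_iff hM (lt_symbolBound hp) b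

theorem hasDegreeOf_orbit_fullExpansion (hM : IsBaseStructure LN N ℕ) (D : Set ℕ) :
    HasDegreeOf (MulAction.orbit (autGroup (langZero LN)) (fullExpansion hM D)) D := by
  rw [orbit_fullExpansion]
  refine ⟨⟨_, rfl, satSet_fullExpansion_setTuringReducible hM D,
    setTuringReducible_satSet_fullExpansion hM D⟩, ?_⟩
  rintro _ rfl
  exact setTuringReducible_satSet_fullExpansion hM D

end FullExpansion

/-! ### Orbits without a degree -/

theorem dense_union_interior_compl {X : Type*} [TopologicalSpace X] (U : Set X) :
    Dense (U ∪ interior Uᶜ) := by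
  rw [interior_compl, dense_iff_closure_eq, closure_union, Set.eq_univ_iff_forall]
  exact fun x => (em (x ∈ closure U)).imp_right fun hx => subset_closure hx

theorem exists_generic {ι : Type*} [Countable ι] {E : ℕ → Type*} [∀ n, Nonempty (E n)]
    (O : ι → Set (∀ n, E n)) (hO : ∀ k, ∀ z ∈ O k, ∃ m, PiNat.cylinder z m ⊆ O k) :
    ∃ z, ∀ k, z ∈ O k ∨ ∃ m, Disjoint (PiNat.cylinder z m) (O k) := by
  let (n : ℕ) : TopologicalSpace (E n) := ⊥
  have (n : ℕ) : DiscreteTopology (E n) := ⟨rfl⟩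
  let := PiNat.metricSpace (E := E)
  have := PiNat.completeSpace (E := E)
  have exists_cylinder {U : Set (∀ n, E n)} (hU : IsOpen U) {z : ∀ n, E n} (hz : z ∈ U) :
      ∃ m, PiNat.cylinder z m ⊆ U := by
    obtain ⟨_, ⟨z', m, rfl⟩, hzz', hm⟩ :=
      (PiNat.isTopologicalBasis_cylinders E).exists_subset_of_mem_open hz hU
    exact ⟨m, PiNat.mem_cylinder_iff_eq.1 hzz' ▸ hm⟩
  have hOopen (k : ι) : IsOpen (O k) := isOpen_iff_mem_nhds.2 fun z hz => by
    obtain ⟨m, hm⟩ := hO k z hz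
    exact Filter.mem_of_superset ((PiNat.isOpen_cylinder E z m).mem_nhds
      (PiNat.self_mem_cylinder z m)) hm
  obtain ⟨z, hz⟩ := (dense_iInter_of_isOpen
    (fun k => (hOopen k).union (isOpen_interior (s := (O k)ᶜ)))
    fun k => dense_union_interior_compl (O k)).nonempty
  refine ⟨z, fun k => (Set.mem_iInter.1 hz k).imp_right fun hk => ?_⟩
  obtain ⟨m, hm⟩ := exists_cylinder isOpen_interior hk
  exact ⟨m, Set.disjoint_left.2 fun z' hz' => interior_subset (hm hz')⟩

theorem initialSegment_prefix {σ : Type*} (g : ℕ → σ) {l m : ℕ} (h : l ≤ m) :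
    initialSegment g l <+: initialSegment g m := by
  obtain ⟨k, rfl⟩ := Nat.exists_eq_add_of_le h
  rw [initialSegment, initialSegment, List.range_add, List.map_append]
  exact List.prefix_append _ _

section SatSegment

variable {LN : FirstOrder.Language.{0, 0}} {N : Type} [LN.Structure N] [langE.Structure ℕ]
  [LN.Structure ℕ]

/-- The initial segment of length `m` of the characteristic function that represents the degree of
the expansion by the classes `c`. -/
noncomputable def satSegment (hM : IsBaseStructure LN N ℕ) (c : ∀ n, Option (ESort (n + 1) ℕ))
    (m : ℕ) : List ℕ :=
  initialSegment (charNat (satSet (classExpansion hM c))) m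

theorem exists_finite_satSegment_congr (hM : IsBaseStructure LN N ℕ) (m : ℕ) :
    ∃ (k : ℕ) (T : ∀ n, Set (ESort (n + 1) ℕ)), (∀ n, (T n).Finite) ∧
      ∀ c c' : ∀ n, Option (ESort (n + 1) ℕ),
        (∀ n < k, ∀ s ∈ T n, c n = some s ↔ c' n = some s) →
          satSegment hM c m = satSegment hM c' m := by
  let D : ℕ → DiagramCode := Denumerable.ofNat DiagramCode
  let A : Set ℕ := ⋃ j ∈ {j | j < m}, {a | a ∈ (D j).1}
  have hA : A.Finite := (Set.finite_lt_nat m).biUnion fun j _ => List.finite_toSet _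
  let I : Set ℕ := ⋃ j ∈ {j | j < m}, Prod.fst '' {p | p ∈ (D j).2.1}
  have hI : I.Finite := (Set.finite_lt_nat m).biUnion fun j _ => (List.finite_toSet _).image _
  obtain ⟨k, hk⟩ := hI.bddAbove
  refine ⟨k + 1, fun n => some ⁻¹' (eClass (n := n + 1) '' {a | ∀ i, a i ∈ A}), fun n => ?_,
    fun c c' hc => initialSegment_congr fun j hj => ?_⟩
  · exact ((Set.Finite.pi' fun _ => hA).image _).preimage (Option.some_injective _).injOn
  · rw [charNat_eq_charNat_iff, mem_satSet_iff, mem_satSet_iff]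
    refine mem_basicSet_congr fun p hp b hb => ?_
    have hpk : p.1 < k + 1 := Nat.lt_succ_of_le (hk (Set.mem_biUnion hj ⟨p, hp, rfl⟩))
    rw [pRel_classExpansion_iff_exists, pRel_classExpansion_iff_exists]
    refine exists_congr fun s => and_congr_left fun hs => and_congr_right fun _ => ?_
    exact hc p.1 hpk s ⟨b, fun i => Set.mem_biUnion hj (hb i), hs⟩

theorem exists_satSegment_congr (hM : IsBaseStructure LN N ℕ)
    (c : ∀ n, Option (ESort (n + 1) ℕ)) (m : ℕ) :
    ∃ k, ∀ c', (∀ n < k, c' n = c n) → satSegment hM c' m = satSegment hM c m := by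
  obtain ⟨k, _, -, hk⟩ := exists_finite_satSegment_congr hM m
  exact ⟨k, fun c' h => hk c' c fun n hn s _ => by rw [h n hn]⟩

theorem exists_satSegment_eq_of_isSome (hM : IsBaseStructure LN N ℕ)
    {c : ∀ n, Option (ESort (n + 1) ℕ)} {A : Set ℕ} (hA : ∀ n, (c n).isSome → n ∈ A) (m : ℕ) :
    ∃ d, (∀ n, (d n).isSome ↔ n ∈ A) ∧ (∀ n, ((c n).isSome ↔ n ∈ A) → d n = c n) ∧
      satSegment hM d m = satSegment hM c m := by
  classical
  obtain ⟨_, T, hT, hTm⟩ := exists_finite_satSegment_congr hM m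
  have hfresh (n : ℕ) : ∃ s, s ∉ T n :=
    have := infinite_eSort hM.1 (n + 1)
    (hT n).exists_notMem
  choose u hu using hfresh
  refine ⟨fun n => if (c n).isSome ↔ n ∈ A then c n else some (u n), fun n => ?_,
    fun n hn => if_pos hn, hTm _ _ fun n _ s hs => ?_⟩
  · dsimp only
    split_ifs with h
    · exact h
    · have := hA n
      simp only [Option.isSome_some, true_iff]
      tauto
  · split_ifs with h
    · rfl
    · have hc : c n = none := by
        have := hA n
        rw [← Option.not_isSome_iff_eq_none]
        tauto
      have hus : u n ≠ s := fun h => hu n (h ▸ hs)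
      simp [hc, hus]

end SatSegment

/-- The function `δ` decides the relations `E_n` on tuples given as lists. -/
structure DecidesERel [langE.Structure ℕ] (δ : List ℕ → List ℕ → Bool) : Prop where
  computable : Computable₂ δ
  iff (n : ℕ) (a b : Fin (n + 1) → ℕ) : δ (List.ofFn a) (List.ofFn b) = true ↔ eRel a b

/-- The first `n + 2` entries of the list `l`, extended by zeros. In particular, the empty list
codes a constant tuple, and so represents the absence of a class. -/
def tupleOfList (n : ℕ) (l : List ℕ) (i : Fin (n + 2)) : ℕ := l.getD i 0

theorem ofFn_tupleOfList (n : ℕ) (l : List ℕ) :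
    List.ofFn (tupleOfList n l) = initialSegment (fun i => l.getD i 0) (n + 2) := by
  refine List.ext_getElem? fun i => ?_
  rw [getElem?_initialSegment, List.getElem?_ofFn]
  split_ifs <;> rfl

section CodedClasses

variable {LN : FirstOrder.Language.{0, 0}} {N : Type} [LN.Structure N] [langE.Structure ℕ]
  [LN.Structure ℕ]

theorem exists_eClass_tupleOfList_eq {n : ℕ} (o : Option (ESort (n + 1) ℕ)) :
    ∃ l, eClass (n := n + 1) (tupleOfList n l) = o := by
  rcases o with _ | s
  · refine ⟨[], eClass_eq_none_iff.2 fun h => ?_⟩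
    exact absurd (h (a₁ := 0) (a₂ := 1) rfl) (by simp)
  · obtain ⟨a, ha⟩ := exists_eClass_eq_some s
    refine ⟨List.ofFn a, ?_⟩
    have : tupleOfList n (List.ofFn a) = a := funext fun i => by
      simp only [tupleOfList, List.getD_eq_getElem?_getD, List.getElem?_ofFn, i.is_lt,
        dif_pos, Option.getD_some]
    rw [this, ha]

/-- The sequence of classes whose first members are coded by the entries of `w`, and which has no
further classes. -/
noncomputable def classesOfLists (w : List (List ℕ)) (n : ℕ) : Option (ESort (n + 1) ℕ) :=
  eClass (n := n + 1) (tupleOfList n (w.getD n []))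

theorem classesOfLists_of_prefix {r : ℕ → List ℕ} {w : List (List ℕ)} {l n : ℕ}
    (hw : initialSegment r l <+: w) (hn : n < l) :
    classesOfLists w n = eClass (n := n + 1) (tupleOfList n (r n)) := by
  obtain ⟨t, rfl⟩ := hw
  have hlen : n < (initialSegment r l).length := by simpa [initialSegment] using hn
  rw [classesOfLists, List.getD_eq_getElem?_getD, List.getElem?_append_left hlen,
    getElem?_initialSegment, if_pos hn, Option.getD_some]

/-- The truth values of the atomic facts in the expansion by the classes coded by `w`. -/
def classFacts (δ : List ℕ → List ℕ → Bool) (w : List (List ℕ)) (r : (ℕ × ℕ) × List ℕ) : Bool :=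
  decide (r.1.2 = 0) && (decide r.2.Nodup &&
    δ r.2 (initialSegment (fun i => (w.getD r.1.1 []).getD i 0) (r.1.1 + 2)))

theorem computable₂_classFacts {δ : List ℕ → List ℕ → Bool} (hδ : DecidesERel δ) :
    Computable₂ (classFacts δ) := by
  have htuple : Computable fun q : List (List ℕ) × (ℕ × ℕ) × List ℕ =>
      initialSegment (fun i => (q.1.getD q.2.1.1 []).getD i 0) (q.2.1.1 + 2) := by
    have hindex : Computable fun q : List (List ℕ) × (ℕ × ℕ) × List ℕ => q.2.1.1 :=
      Computable.fst.comp (Computable.fst.comp Computable.snd)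
    have hlist : Computable fun q : List (List ℕ) × (ℕ × ℕ) × List ℕ => q.1.getD q.2.1.1 [] :=
      (Primrec.list_getD []).to_comp.comp Computable.fst hindex
    exact computable_initialSegment (Primrec.nat_add.to_comp.comp hindex (Computable.const 2))
      ((Primrec.list_getD 0).to_comp.comp (hlist.comp Computable.fst) Computable.snd)
  have hzero : Primrec fun q : List (List ℕ) × (ℕ × ℕ) × List ℕ => decide (q.2.1.2 = 0) :=
    (PrimrecRel.decide Primrec.eq).comp
      (Primrec.snd.comp (Primrec.fst.comp Primrec.snd)) (Primrec.const 0)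
  exact Primrec.and.to_comp.comp hzero.to_comp (Primrec.and.to_comp.comp
    (primrec_list_nodup.to_comp.comp (Computable.snd.comp Computable.snd))
    (hδ.computable.comp (Computable.snd.comp Computable.snd) htuple))

theorem classFacts_iff (hM : IsBaseStructure LN N ℕ) {δ : List ℕ → List ℕ → Bool}
    (hδ : DecidesERel δ) (w : List (List ℕ)) (p : ℕ × ℕ) (b : Fin (p.1 + 2) → ℕ) :
    classFacts δ w (p, List.ofFn b) = true ↔
      pRel (classExpansion hM (classesOfLists w)).1 p.1 p.2 b := by
  rw [pRel_classExpansion]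
  simp only [classFacts, Bool.and_eq_true, decide_eq_true_eq, List.nodup_ofFn]
  rw [← ofFn_tupleOfList, hδ.iff (p.1 + 1), (isEStructure_of_isFraisseLimit hM.1).eRel_iff,
    ← isSome_eClass (n := p.1 + 1)]
  exact and_congr_right fun _ => and_congr_left fun h => by rw [h, classesOfLists]

theorem satSegment_classesOfLists (hM : IsBaseStructure LN N ℕ) {δ : List ℕ → List ℕ → Bool}
    (hδ : DecidesERel δ) (w : List (List ℕ)) (m : ℕ) :
    satSegment hM (classesOfLists w) m = initialSegment (satFun (classFacts δ w)) m :=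
  initialSegment_congr fun _ _ => charNat_satSet_eq_satFun fun p _ => classFacts_iff hM hδ w p

end CodedClasses

section NoDegree

open Nat.Partrec (Code)

variable {LN : FirstOrder.Language.{0, 0}} {N : Type} [LN.Structure N] [langE.Structure ℕ]
  [LN.Structure ℕ]

/-- Some values of the functional `e` relative to the expansion by the classes `c` and of the
functional `e'` relative to the expansion by the classes `c'` are different. -/
def FunctionalsDisagree (hM : IsBaseStructure LN N ℕ) (e e' : Code)
    (c c' : ∀ n, Option (ESort (n + 1) ℕ)) : Prop :=
  ∃ k m m', ∃ v ∈ functional e (satSegment hM c m) k,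
    ∃ v' ∈ functional e' (satSegment hM c' m') k, v ≠ v'

theorem FunctionalsDisagree.exists_congr {hM : IsBaseStructure LN N ℕ} {e e' : Code}
    {c c' : ∀ n, Option (ESort (n + 1) ℕ)} (h : FunctionalsDisagree hM e e' c c') :
    ∃ l, ∀ d d', (∀ n < l, d n = c n ∧ d' n = c' n) → FunctionalsDisagree hM e e' d d' := by
  obtain ⟨k, m, m', v, hv, v', hv', hne⟩ := h
  obtain ⟨l, hl⟩ := exists_satSegment_congr hM c m
  obtain ⟨l', hl'⟩ := exists_satSegment_congr hM c' m'
  refine ⟨max l l', fun d d' hd => ⟨k, m, m', v, ?_, v', ?_, hne⟩⟩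
  · rwa [hl d fun n hn => (hd n (lt_max_of_lt_left hn)).1]
  · rwa [hl' d' fun n hn => (hd n (lt_max_of_lt_right hn)).2]

theorem exists_generic_pair (hM : IsBaseStructure LN N ℕ) {𝓑 : Set (Set ℕ)} (h𝓑 : 𝓑.Countable) :
    ∃ c c' : ∀ n, Option (ESort (n + 1) ℕ), (∀ n, (c n).isSome = (c' n).isSome) ∧
      {n | (c n).isSome} ∉ 𝓑 ∧
      ∀ e e', FunctionalsDisagree hM e e' c c' ∨
        ∃ l, ∀ d d', (∀ n, (d n).isSome = (d' n).isSome) →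
          (∀ n < l, d n = c n ∧ d' n = c' n) → ¬ FunctionalsDisagree hM e e' d d' := by
  have := h𝓑.to_subtype
  let E (n : ℕ) : Type :=
    {p : Option (ESort (n + 1) ℕ) × Option (ESort (n + 1) ℕ) // p.1.isSome = p.2.isSome}
  have (n : ℕ) : Nonempty (E n) := ⟨(none, none), rfl⟩
  let O : (Code × Code) ⊕ 𝓑 → Set (∀ n, E n)
    | .inl e => {z | FunctionalsDisagree hM e.1 e.2 (fun n => (z n).1.1) fun n => (z n).1.2}
    | .inr B => {z | ∃ n, ¬ ((z n).1.1.isSome ↔ n ∈ B.1)}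
  have hO : ∀ i, ∀ z ∈ O i, ∃ m, PiNat.cylinder z m ⊆ O i := by
    rintro (e | B) z hz
    · obtain ⟨l, hl⟩ := FunctionalsDisagree.exists_congr hz
      exact ⟨l, fun z' hz' => hl _ _ fun n hn => by rw [hz' n hn]; exact ⟨rfl, rfl⟩⟩
    · obtain ⟨n, hn⟩ := hz
      exact ⟨n + 1, fun z' hz' => ⟨n, by rwa [hz' n n.lt_succ_self]⟩⟩
  obtain ⟨z, hz⟩ := exists_generic O hO
  refine ⟨fun n => (z n).1.1, fun n => (z n).1.2, fun n => (z n).2, fun hB => ?_,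
    fun e e' => (hz (.inl (e, e'))).imp_right ?_⟩
  · rcases hz (.inr ⟨_, hB⟩) with ⟨n, hn⟩ | ⟨m, hm⟩
    · exact hn Iff.rfl
    · obtain ⟨s⟩ := (infinite_eSort hM.1 (m + 1)).nonempty
      let u : E m := if (z m).1.1.isSome then ⟨(none, none), rfl⟩ else ⟨(some s, some s), rfl⟩
      refine Set.disjoint_left.1 hm (PiNat.update_mem_cylinder z m u) ⟨m, ?_⟩
      by_cases h : (z m).1.1.isSome <;> simp [u, h]
  · rintro ⟨l, hl⟩
    refine ⟨l, fun d d' hsome hd hdis => ?_⟩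
    let z' (n : ℕ) : E n := ⟨(d n, d' n), hsome n⟩
    have hz' : z' ∈ PiNat.cylinder z l := fun n hn =>
      Subtype.ext (Prod.ext (hd n hn).1 (hd n hn).2)
    exact Set.disjoint_left.1 hl hz' hdis

theorem eq_of_forall_not_functionalsDisagree {hM : IsBaseStructure LN N ℕ} {e e' : Code}
    {c c' : ∀ n, Option (ESort (n + 1) ℕ)} {l : ℕ} (hcc' : ∀ n, (c n).isSome = (c' n).isSome)
    (hl : ∀ d d', (∀ n, (d n).isSome = (d' n).isSome) →
      (∀ n < l, d n = c n ∧ d' n = c' n) → ¬ FunctionalsDisagree hM e e' d d')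
    {d : ∀ n, Option (ESort (n + 1) ℕ)} (hd : ∀ n < l, d n = c n) {k m m' v v' : ℕ}
    (hv : v ∈ functional e (satSegment hM d m) k)
    (hv' : v' ∈ functional e' (satSegment hM c' m') k) : v = v' := by
  -- The supports of `d` and `c'` may differ beyond `l`: add fresh classes on both sides.
  let A : Set ℕ := {n | (d n).isSome ∨ (c' n).isSome}
  obtain ⟨d₁, hA₁, hd₁, hm₁⟩ := exists_satSegment_eq_of_isSome hM (c := d) (A := A)
    (fun n => Or.inl) m
  obtain ⟨d₂, hA₂, hd₂, hm₂⟩ := exists_satSegment_eq_of_isSome hM (c := c') (A := A)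
    (fun n => Or.inr) m'
  by_contra hne
  refine hl d₁ d₂ (fun n => Bool.eq_iff_iff.2 ((hA₁ n).trans (hA₂ n).symm)) (fun n hn => ?_)
    ⟨k, m, m', v, hm₁ ▸ hv, v', hm₂ ▸ hv', hne⟩
  have hsome : (d n).isSome = (c' n).isSome := by rw [hd n hn, hcc']
  exact ⟨(hd₁ n (by simp [A, hsome])).trans (hd n hn), hd₂ n (by simp [A, hsome])⟩

theorem partrec₂_functional_classFacts {δ : List ℕ → List ℕ → Bool} (hδ : DecidesERel δ)
    (e : Code) (w : List (List ℕ)) :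
    Partrec₂ fun k (t : List (List ℕ) × ℕ) =>
      functional e (initialSegment (satFun (classFacts δ (w ++ t.1))) t.2) k := by
  have hlists : Computable fun q : ℕ × List (List ℕ) × ℕ => w ++ q.2.1 :=
    Computable.list_append.comp (Computable.const w) (Computable.fst.comp Computable.snd)
  have hsat : Computable₂ fun (q : ℕ × List (List ℕ) × ℕ) m =>
      satFun (classFacts δ (w ++ q.2.1)) m :=
    (computable₂_satFun (computable₂_classFacts hδ)).comp (hlists.comp Computable.fst)
      Computable.snd
  have hsegment : Computable fun q : ℕ × List (List ℕ) × ℕ =>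
      initialSegment (satFun (classFacts δ (w ++ q.2.1))) q.2.2 :=
    computable_initialSegment (Computable.snd.comp Computable.snd) hsat
  exact (partrec₂_functional e).comp hsegment Computable.fst

theorem computable_of_forall_not_functionalsDisagree {hM : IsBaseStructure LN N ℕ}
    {δ : List ℕ → List ℕ → Bool} (hδ : DecidesERel δ) {e e' : Code}
    {c c' : ∀ n, Option (ESort (n + 1) ℕ)} {l : ℕ} (hcc' : ∀ n, (c n).isSome = (c' n).isSome)
    (hl : ∀ d d', (∀ n, (d n).isSome = (d' n).isSome) →
      (∀ n < l, d n = c n ∧ d' n = c' n) → ¬ FunctionalsDisagree hM e e' d d')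
    {g : ℕ → ℕ} (hg : ∀ k, ∃ m, g k ∈ functional e (satSegment hM c m) k)
    (hg' : ∀ k, ∃ m, g k ∈ functional e' (satSegment hM c' m) k) : Computable g := by
  choose r hr using fun n => exists_eClass_tupleOfList_eq (c n)
  have hprefix {w j n} (hw : initialSegment r j <+: w) (hn : n < j) : classesOfLists w n = c n :=
    (classesOfLists_of_prefix hw hn).trans (hr n)
  let w₀ := initialSegment r l
  -- Search for a finite sequence of coded classes that extends `w₀` and yields some value.
  refine computable_of_partrec_search (β := List (List ℕ) × ℕ) (f := fun k t =>
    functional e (initialSegment (satFun (classFacts δ (w₀ ++ t.1))) t.2) k)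
    (partrec₂_functional_classFacts hδ e w₀) (fun k t v hv => ?_) fun k => ?_
  · obtain ⟨m', hm'⟩ := hg' k
    rw [← satSegment_classesOfLists hM hδ] at hv
    exact eq_of_forall_not_functionalsDisagree hcc' hl
      (fun n hn => hprefix (List.prefix_append _ _) hn) hv hm'
  · obtain ⟨m, hm⟩ := hg k
    obtain ⟨j, hj⟩ := exists_satSegment_congr hM c m
    obtain ⟨t, ht⟩ := initialSegment_prefix r (le_max_left l j)
    refine ⟨(t, m), ?_⟩
    rw [ht, ← satSegment_classesOfLists hM hδ, hj]
    · exact hm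
    · exact fun n hn => hprefix List.prefix_rfl (lt_max_of_lt_right hn)

theorem countable_support_of_partrec :
    {A | ∃ y : Expansions LN N, Partrec (charFun (satSet y)) ∧ support y = A}.Countable := by
  have hpartrec : {f : ℕ →. ℕ | Partrec f}.Countable :=
    Set.countable_coe_iff.1 (inferInstanceAs (Countable {f : ℕ →. ℕ // Partrec f}))
  refine ((hpartrec.preimage charFun_injective).image fun B =>
    {n | ∃ L, Encodable.encode ((L, [(n, 0)], []) : DiagramCode) ∉ B}).mono ?_
  rintro _ ⟨y, hy, rfl⟩
  refine ⟨satSet y, hy, Set.ext fun n => ?_⟩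
  simp only [Set.mem_ofPred_eq, encode_mem_satSet_iff, mem_basicSet_nil_iff, not_forall, not_not]
  exact ⟨fun ⟨_, b, _, hb⟩ => ⟨b, hb⟩,
    fun ⟨b, hb⟩ => ⟨List.ofFn b, b, fun j => List.mem_ofFn.2 ⟨j, rfl⟩, hb⟩⟩

theorem exists_classExpansion_not_hasDegreeOf [LN.IsRelational] (hM : IsBaseStructure LN N ℕ)
    {δ : List ℕ → List ℕ → Bool} (hδ : DecidesERel δ) :
    ∃ c, ∀ D, ¬ HasDegreeOf
      (MulAction.orbit (autGroup (langZero LN)) (classExpansion hM c)) D := by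
  obtain ⟨c, c', hcc', hc, hgeneric⟩ :=
    exists_generic_pair hM (countable_support_of_partrec (LN := LN) (N := N))
  refine ⟨c, fun D ⟨⟨y, hy, hyD, _⟩, hD⟩ => hc ⟨y, ?_, ?_⟩⟩
  · obtain ⟨e, he⟩ := (hD _ (MulAction.mem_orbit_self _)).exists_functional
    obtain ⟨e', he'⟩ := (hD _ (classExpansion_mem_orbit hM hcc')).exists_functional
    have hD : Computable (charNat D) := by
      rcases hgeneric e e' with ⟨k, m, m', v, hv, v', hv', hne⟩ | ⟨l, hl⟩
      · exact absurd (((he k v).2 ⟨m, hv⟩).trans ((he' k v').2 ⟨m', hv'⟩).symm) hne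
      · exact computable_of_forall_not_functionalsDisagree hδ hcc' hl
          (fun k => (he k _).1 rfl) fun k => (he' k _).1 rfl
    exact RecursiveIn.partrec_of_oracle (by rintro _ rfl; exact hD.partrec) hyD
  · ext n
    rw [support_eq_of_mem_orbit hy, mem_support_classExpansion, Set.mem_ofPred_eq]

end NoDegree

/-! ### Decidability of the relations `E_n` -/

section ElementaryDiagram

/-- The Gödel number of the atomic formula that relates the tuples `l` and `l'` of parameters. -/
def eRelCode (l l' : List ℕ) : ℕ :=
  Nat.pair 2 (Nat.pair (2 * (l.length - 1)) (Encodable.encode ((l ++ l').map fun k => 2 * k)))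

theorem computable₂_eRelCode : Computable₂ eRelCode := by
  refine Primrec.to_comp (f := fun q : List ℕ × List ℕ => eRelCode q.1 q.2) ?_
  refine Primrec₂.natPair.comp (Primrec.const 2) (Primrec₂.natPair.comp
    (Primrec.nat_double.comp (Primrec.nat_sub.comp (Primrec.list_length.comp Primrec.fst)
      (Primrec.const 1))) (Primrec.encode.comp ?_))
  exact Primrec.list_map (Primrec.list_append.comp Primrec.fst Primrec.snd)
    (Primrec.nat_double.comp Primrec.snd)

theorem eRelCode_ofFn {n : ℕ} (a b : Fin (n + 1) → ℕ) :
    eRelCode (List.ofFn a) (List.ofFn b) = Nat.pair 2 (Nat.pair (2 * n)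
      (Encodable.encode (List.ofFn fun i => 2 * Fin.append a b i))) := by
  unfold eRelCode
  rw [← List.ofFn_fin_append, List.map_ofFn, List.length_ofFn, Nat.add_sub_cancel]
  rfl

theorem realize_of_termCode_eq {L : FirstOrder.Language.{0, 0}} [L.IsRelational] [L.Structure ℕ]
    {t : L.Term (ℕ ⊕ Fin 0)} {k : ℕ} (h : termCode t = 2 * k) (v : Fin 0 → ℕ) :
    t.realize (Sum.elim id v) = k := by
  rcases t with (a | i) | ⟨f, ts⟩
  · simp only [termCode, Encodable.encode_nat] at h
    exact Nat.eq_of_mul_eq_mul_left two_pos h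
  · exact i.elim0
  · exact isEmptyElim f

variable {LN : FirstOrder.Language.{0, 0}} [LN.IsRelational] {c : (Σ n, LN.Relations n) → ℕ}

theorem exists_rel_of_formulaCode_eq {n : ℕ} {a b : Fin (n + 1) → ℕ}
    {φ : (langZero LN).Formula ℕ}
    (hφ : formulaCode (symCodeZero c) φ = eRelCode (List.ofFn a) (List.ofFn b)) :
    ∃ ts, φ = BoundedFormula.rel (L := langZero LN) (Sum.inl (ERel.E n)) ts ∧
      ∀ i, termCode (ts i) = 2 * Fin.append a b i := by
  rw [eRelCode_ofFn] at hφ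
  cases φ with
  | falsum => simp [formulaCode, Nat.pair_eq_pair] at hφ
  | equal s t => simp [formulaCode, Nat.pair_eq_pair] at hφ
  | imp φ ψ => simp [formulaCode, Nat.pair_eq_pair] at hφ
  | all φ => simp [formulaCode, Nat.pair_eq_pair] at hφ
  | rel R ts =>
    simp only [formulaCode, Nat.pair_eq_pair, true_and] at hφ
    obtain ⟨hR, hts⟩ := hφ
    rcases R with R | R
    · obtain ⟨n'⟩ : ERel _ := R
      obtain rfl : n' = n := Nat.eq_of_mul_eq_mul_left two_pos hR
      exact ⟨ts, rfl, congrFun (List.ofFn_injective (Encodable.encode_injective hts))⟩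
    · simp only [symCodeZero] at hR
      omega

variable [langE.Structure ℕ] [LN.Structure ℕ]

theorem exists_formulaCode_eq_eRelCode_iff {n : ℕ} (a b : Fin (n + 1) → ℕ) :
    (∃ φ : (langZero LN).Formula ℕ, formulaCode (symCodeZero c) φ =
      eRelCode (List.ofFn a) (List.ofFn b) ∧ φ.Realize id) ↔ eRel a b := by
  constructor
  · rintro ⟨φ, hφ, hr⟩
    obtain ⟨ts, rfl, hts⟩ := exists_rel_of_formulaCode_eq hφ
    obtain ⟨v, hv⟩ : ∃ v : Fin 0 → ℕ, Structure.RelMap (L := langE) (ERel.E n)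
        fun i => (ts i).realize (Sum.elim id v) := ⟨_, hr⟩
    rwa [funext fun i => realize_of_termCode_eq (hts i) v] at hv
  · refine fun h => ⟨BoundedFormula.rel (L := langZero LN) (Sum.inl (ERel.E n))
      fun i => Term.var (Sum.inl (Fin.append a b i)), ?_, h⟩
    rw [eRelCode_ofFn]
    rfl

theorem exists_decidesERel
    (hMdec : HasDecidableElementaryDiagram (L := langZero LN) (symCodeZero c)) :
    ∃ δ, DecidesERel δ := by
  obtain ⟨_, hcomp⟩ := hMdec
  exact ⟨fun l l' => decide (∃ φ : (langZero LN).Formula ℕ,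
    formulaCode (symCodeZero c) φ = eRelCode l l' ∧ φ.Realize id),
    hcomp.comp computable₂_eRelCode, fun _ a b =>
    decide_eq_true_iff.trans (exists_formulaCode_eq_eRelCode_iff a b)⟩

end ElementaryDiagram

theorem theorem4p4_general {LN : FirstOrder.Language.{0, 0}} [LN.IsRelational] {N : Type}
    [LN.Structure N] [langE.Structure ℕ] [LN.Structure ℕ] (hM : IsBaseStructure LN N ℕ)
    {δ : List ℕ → List ℕ → Bool} (hδ : DecidesERel δ) :
    (∀ D : Set ℕ, ∃ x : Expansions LN N,
      IsCanonicalPiece (autGroup (langZero LN)) basicSet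
          (MulAction.orbit (autGroup (langZero LN)) x) ∧
        HasDegreeOf (MulAction.orbit (autGroup (langZero LN)) x) D) ∧
    ∃ x : Expansions LN N,
      IsCanonicalPiece (autGroup (langZero LN)) basicSet
          (MulAction.orbit (autGroup (langZero LN)) x) ∧
        ¬ ∃ D : Set ℕ, HasDegreeOf (MulAction.orbit (autGroup (langZero LN)) x) D := by
  refine ⟨fun D => ⟨fullExpansion hM D, isCanonicalPiece_fullExpansion hM D,
    hasDegreeOf_orbit_fullExpansion hM D⟩, ?_⟩
  obtain ⟨c, hc⟩ := exists_classExpansion_not_hasDegreeOf hM hδ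
  exact ⟨classExpansion hM c, isCanonicalPiece_classExpansion hM c, not_exists.2 hc⟩

theorem theorem4p4 (LN : FirstOrder.Language.{0, 0}) [LN.IsRelational] (c : ComputableLanguage LN)
    (N : Type) [LN.Structure N] [Countable N] [Infinite N]
    (hcat : Cardinal.Categorical (Cardinal.aleph0.{0}) (LN.completeTheory N))
    (hmc : IsModelComplete (LN.completeTheory N))
    (hdec : HasDecidableTheory c.symCode N)
    [langE.Structure ℕ] [LN.Structure ℕ] (hM : IsBaseStructure LN N ℕ)
    (hMdec : HasDecidableElementaryDiagram (L := langZero LN) (symCodeZero c.symCode)) :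
    (∀ D : Set ℕ, ∃ x : Expansions LN N,
      IsCanonicalPiece (autGroup (langZero LN)) basicSet
          (MulAction.orbit (autGroup (langZero LN)) x) ∧
        HasDegreeOf (MulAction.orbit (autGroup (langZero LN)) x) D) ∧
    ∃ x : Expansions LN N,
      IsCanonicalPiece (autGroup (langZero LN)) basicSet
          (MulAction.orbit (autGroup (langZero LN)) x) ∧
        ¬ ∃ D : Set ℕ, HasDegreeOf (MulAction.orbit (autGroup (langZero LN)) x) D := by
  obtain ⟨_, hδ⟩ := exists_decidesERel hMdec
  exact theorem4p4_general hM hδ
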